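/- Let $n \ge 1$, $t_0 \in \mathbb R$, and consider the system $$\dot x = f(t,x), \qquad t \ge t_0, \quad x \in \mathbb R^n.$$ Assume that $f$ is piecewise continuous in $t$ (off a set of times common to all $x$ and with finitely many points in each bounded interval, $f(\cdot,x)$ is continuous, and one-sided limits in $t$ exist everywhere), that $f(t,\cdot)$ is continuously differentiable for every $t \ge t_0$, with Jacobian matrix $\frac{\partial f}{\partial x}$ bounded on compact subsets of $[t_0,\infty)\times\mathbb R^n$, and that for every $x \in \mathbb R^n$ the (absolutely continuous) solution $\xi(t,t_0,x)$ with $\xi(t_0,t_0,x)=x$ exists for all $t \ge t_0$. Let $K \subset \mathbb R^n$ be compact with nonempty interior, and write $\xi(t,t_0,K) = \{\xi(t,t_0,x) : x \in K\}$. Fix a norm $|\cdot|$ on $\mathbb R^n$. For $T \ge 0$ and $\varepsilon>0$ let $S(f,t_0,\varepsilon,T,K)$ be the minimal cardinality of a set $E \subset K$ such that for every $\bar x \in K$ there is $x \in E$ with $|\xi(t,t_0,\bar x)-\xi(t,t_0,x)| < \varepsilon$ for all $t \in [t_0,t_0+T]$. The topological entropy is $$h(f,t_0,K) := \lim_{\varepsilon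 \searrow 0}\ \limsup_{T\to\infty} \frac1T \log S(f,t_0,\varepsilon,T,K) \in [0,\infty].$$ For any norm on $\mathbb R^n$ (possibly different from $|\cdot|$), with induced matrix norm $\|\cdot\|$, let $\mu(A) := \lim_{s\searrow 0} \frac{\|I+sA\|-1}{s}$ be the matrix measure of $A \in \mathbb R^{n\times n}$. Then $$\max\{\check\chi,0\} \;\le\; h(f,t_0,K) \;\le\; n \max\{\hat\mu,0\},$$ where, as extended real numbers, $$\hat\mu := \limsup_{t\to\infty}\ \max_{v\in \mathrm{co}(\xi(t,t_0,K))} \mu\Big(\frac{\partial f}{\partial x}(t,v)\Big), \qquad \check\chi := \liminf_{t\to\infty}\ \min_{v\in \xi(t,t_0,K)} \mathrm{tr}\Big(\frac{\partial f}{\partial x}(t,v)\Big),$$ and $\mathrm{co}$ denotes the convex hull. -/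

import Mathlib

open Set Filter Topology MeasureTheory

/-- `f` is piecewise continuous in time on `[t₀, ∞)`: there is a set `D` of exceptional times, common
to all states and with finitely many points in each bounded interval, off which `f(·, x)` is
continuous, and all one-sided limits in time exist (in `ℝⁿ`). -/
def PiecewiseContinuousInTime {n : ℕ} (f : ℝ → (Fin n → ℝ) → (Fin n → ℝ)) (t₀ : ℝ) : Prop :=
  ∃ D : Set ℝ, (∀ T : ℝ, (D ∩ Icc t₀ T).Finite) ∧
    (∀ x : Fin n → ℝ, ∀ t ∈ Ici t₀ \ D, ContinuousWithinAt (fun s => f s x) (Ici t₀) t) ∧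
    (∀ x : Fin n → ℝ, ∀ t ∈ Ici t₀, ∃ l, Tendsto (fun s => f s x) (𝓝[>] t) (𝓝 l)) ∧
    (∀ x : Fin n → ℝ, ∀ t ∈ Ioi t₀, ∃ l, Tendsto (fun s => f s x) (𝓝[<] t) (𝓝 l))

/-- The Jacobian matrix `∂f/∂x (t, v)`. -/
noncomputable def jacobian {n : ℕ} (f : ℝ → (Fin n → ℝ) → (Fin n → ℝ)) (t : ℝ)
    (v : Fin n → ℝ) : Matrix (Fin n) (Fin n) ℝ :=
  LinearMap.toMatrix' (fderiv ℝ (f t) v : (Fin n → ℝ) →ₗ[ℝ] (Fin n → ℝ))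

/-- The entries of `∂f/∂x` are bounded on compact subsets of `[t₀, ∞) × ℝⁿ`. -/
def JacobianLocallyBounded {n : ℕ} (f : ℝ → (Fin n → ℝ) → (Fin n → ℝ)) (t₀ : ℝ) : Prop :=
  ∀ T R : ℝ, ∃ C : ℝ, ∀ t ∈ Icc t₀ T, ∀ v : Fin n → ℝ, ‖v‖ ≤ R →
    ∀ i j : Fin n, |jacobian f t v i j| ≤ C

/-- `φ` is a solution on `[t₀, ∞)` of `ẋ = f(t, x)`, `x(t₀) = x₀`, in the integral form, that is,
`φ` is locally absolutely continuous and satisfies the equation almost everywhere. -/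
def IsSolution {n : ℕ} (f : ℝ → (Fin n → ℝ) → (Fin n → ℝ)) (t₀ : ℝ) (x₀ : Fin n → ℝ)
    (φ : ℝ → (Fin n → ℝ)) : Prop :=
  ∀ t, t₀ ≤ t → IntervalIntegrable (fun s => f s (φ s)) volume t₀ t ∧
    φ t = x₀ + ∫ s in t₀..t, f s (φ s)

/-- Every initial state at time `t₀` has a solution that exists on all of `[t₀, ∞)`. -/
def ForwardComplete {n : ℕ} (f : ℝ → (Fin n → ℝ) → (Fin n → ℝ)) (t₀ : ℝ) : Prop :=
  ∀ x₀ : Fin n → ℝ, ∃ φ : ℝ → (Fin n → ℝ), IsSolution f t₀ x₀ φ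

/-- `ξ(t, t₀, x)`: the value at time `t` of the solution with state `x` at time `t₀`. -/
noncomputable def flow {n : ℕ} (f : ℝ → (Fin n → ℝ) → (Fin n → ℝ)) (t₀ t : ℝ)
    (x : Fin n → ℝ) : Fin n → ℝ :=
  Classical.epsilon (fun φ : ℝ → (Fin n → ℝ) => IsSolution f t₀ x φ) t

/-- The reachable set `ξ(t, t₀, K)`. -/
noncomputable def reachableSet {n : ℕ} (f : ℝ → (Fin n → ℝ) → (Fin n → ℝ)) (t₀ t : ℝ)
    (K : Set (Fin n → ℝ)) : Set (Fin n → ℝ) :=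
  flow f t₀ t '' K

/-- `E ⊆ K` is `(T, ε)`-spanning, the distance between states being measured by the norm `N`. -/
def IsSpanning {n : ℕ} (N : Seminorm ℝ (Fin n → ℝ)) (f : ℝ → (Fin n → ℝ) → (Fin n → ℝ)) (t₀ : ℝ)
    (K : Set (Fin n → ℝ)) (T ε : ℝ) (E : Set (Fin n → ℝ)) : Prop :=
  E ⊆ K ∧ ∀ y ∈ K, ∃ x ∈ E, ∀ t ∈ Icc t₀ (t₀ + T), N (flow f t₀ t y - flow f t₀ t x) < ε

/-- `S(f, t₀, ε, T, K)`: the minimal cardinality of a `(T, ε)`-spanning set. -/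
noncomputable def spanningNumber {n : ℕ} (N : Seminorm ℝ (Fin n → ℝ))
    (f : ℝ → (Fin n → ℝ) → (Fin n → ℝ)) (t₀ : ℝ) (K : Set (Fin n → ℝ)) (T ε : ℝ) : ℕ∞ :=
  ⨅ E ∈ {E : Set (Fin n → ℝ) | IsSpanning N f t₀ K T ε E}, E.encard

/-- The topological entropy `h(f, t₀, K) = lim_{ε ↘ 0} limsup_{T → ∞} (1/T) log S(f, t₀, ε, T, K)`,
an extended real number; the limit exists because `S` is antitone in `ε`. -/
noncomputable def topEntropy {n : ℕ} (N : Seminorm ℝ (Fin n → ℝ))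
    (f : ℝ → (Fin n → ℝ) → (Fin n → ℝ)) (t₀ : ℝ) (K : Set (Fin n → ℝ)) : EReal :=
  limUnder (𝓝[>] (0 : ℝ)) (fun ε : ℝ =>
    limsup (fun T : ℝ =>
      ((1 / T : ℝ) : EReal) * ENNReal.log (spanningNumber N f t₀ K T ε : ENNReal)) atTop)

/-- The norm on matrices that is induced by the norm `N` on `ℝⁿ`. -/
noncomputable def inducedNorm {n : ℕ} (N : Seminorm ℝ (Fin n → ℝ))
    (A : Matrix (Fin n) (Fin n) ℝ) : ℝ :=
  sSup ((fun v : Fin n → ℝ => N (A.mulVec v)) '' {v | N v ≤ 1})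

/-- The matrix measure (logarithmic norm) `μ(A) = lim_{s ↘ 0} (‖I + s A‖ - 1) / s`. -/
noncomputable def matrixMeasure {n : ℕ} (N : Seminorm ℝ (Fin n → ℝ))
    (A : Matrix (Fin n) (Fin n) ℝ) : ℝ :=
  limUnder (𝓝[>] (0 : ℝ)) (fun s : ℝ => (inducedNorm N (1 + s • A) - 1) / s)

/-- `μ̂ = limsup_{t → ∞} max { μ(∂f/∂x (t, v)) | v ∈ co ξ(t, t₀, K) }`. -/
noncomputable def muHat {n : ℕ} (N : Seminorm ℝ (Fin n → ℝ))
    (f : ℝ → (Fin n → ℝ) → (Fin n → ℝ)) (t₀ : ℝ) (K : Set (Fin n → ℝ)) : EReal :=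
  limsup (fun t : ℝ => ⨆ v ∈ convexHull ℝ (reachableSet f t₀ t K),
    (matrixMeasure N (jacobian f t v) : EReal)) atTop

/-- `χ̌ = liminf_{t → ∞} min { tr (∂f/∂x (t, v)) | v ∈ ξ(t, t₀, K) }`. -/
noncomputable def chiCheck {n : ℕ} (f : ℝ → (Fin n → ℝ) → (Fin n → ℝ)) (t₀ : ℝ)
    (K : Set (Fin n → ℝ)) : EReal :=
  liminf (fun t : ℝ => ⨅ v ∈ reachableSet f t₀ t K,
    ((jacobian f t v).trace : EReal)) atTop

/-!
Upper bound. For two orbits starting in `K`, the difference `e = y - x` satisfies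
`ė = f(t, y) - f(t, x)`. A supporting functional of the norm `M` at `e`, the mean value theorem on
the segment from `x` to `y` and the definition of the matrix measure bound the derivative of `M e`
by `c * M e` for every `c > max μ̂ 0` and all large times, so by Gronwall orbits separate at most
like `exp (c T)`. A grid of mesh of order `exp (-c T)` is then spanning on `[t₀, t₀ + T]`, and it
has `O(exp (n c T))` points.

Lower bound. The flow is injective and locally Lipschitz, hence differentiable almost everywhere by
Rademacher's theorem, and for almost every initial point its Jacobian is an absolutely continuous
solution of the variational equation. By Liouville's formula and the change of variables theorem
the volume of `ξ(t, t₀, K)` grows at least like `exp (c t)` for every `c < χ̌`. The sets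
`{v | N (v - ξ(t₀ + T, t₀, x)) < ε}`, for `x` in a spanning set, cover `ξ(t₀ + T, t₀, K)` and all
have the same volume, so a spanning set has at least of the order of `exp (c T)` elements.
-/

section AbsolutelyContinuous

variable {a b : ℝ}

theorem absolutelyContinuousOnInterval_const {X : Type*} [PseudoMetricSpace X] (c : X) (a b : ℝ) :
    AbsolutelyContinuousOnInterval (fun _ => c) a b := by
  simpa [AbsolutelyContinuousOnInterval] using tendsto_const_nhds

theorem absolutelyContinuousOnInterval_pi {ι X : Type*} [Fintype ι] [PseudoMetricSpace X]
    {F : ℝ → ι → X} (hF : ∀ i, AbsolutelyContinuousOnInterval (fun t => F t i) a b) :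
    AbsolutelyContinuousOnInterval F a b := by
  refine squeeze_zero (fun E => Finset.sum_nonneg fun _ _ => dist_nonneg) (fun E => ?_)
    (by simpa using tendsto_finsetSum Finset.univ fun i _ => hF i)
  rw [Finset.sum_comm]
  gcongr with k
  exact (dist_pi_le_iff (by positivity)).2 fun i =>
    Finset.single_le_sum (f := fun i => dist (F (E.2 k).1 i) (F (E.2 k).2 i))
      (fun _ _ => dist_nonneg) (Finset.mem_univ i)

theorem absolutelyContinuousOnInterval_of_dist_le_mul {X Y : Type*} [PseudoMetricSpace X]
    [PseudoMetricSpace Y] {F : ℝ → X} {G : ℝ → Y} (hG : AbsolutelyContinuousOnInterval G a b)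
    {C : ℝ} (hFG : ∀ s ∈ uIcc a b, ∀ t ∈ uIcc a b, dist (F s) (F t) ≤ C * dist (G s) (G t)) :
    AbsolutelyContinuousOnInterval F a b := by
  refine squeeze_zero' (.of_forall fun E => Finset.sum_nonneg fun _ _ => dist_nonneg) ?_
    (by simpa using Filter.Tendsto.const_mul C hG)
  filter_upwards [mem_inf_of_right (mem_principal_self _)] with E hE
  rw [Finset.mul_sum]
  exact Finset.sum_le_sum fun k hk => hFG _ (hE.1 k hk).1 _ (hE.1 k hk).2

variable {ι : Type*} (s : Finset ι) {F : ι → ℝ → ℝ}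

theorem absolutelyContinuousOnInterval_finset_sum
    (hF : ∀ i ∈ s, AbsolutelyContinuousOnInterval (F i) a b) :
    AbsolutelyContinuousOnInterval (fun t => ∑ i ∈ s, F i t) a b := by
  classical
  induction s using Finset.induction_on with
  | empty => simpa using absolutelyContinuousOnInterval_const (0 : ℝ) a b
  | insert i s hi ih =>
    simp only [Finset.sum_insert hi]
    exact (hF i (by simp)).fun_add (ih fun j hj => hF j (by simp [hj]))

theorem absolutelyContinuousOnInterval_finset_prod
    (hF : ∀ i ∈ s, AbsolutelyContinuousOnInterval (F i) a b) :
    AbsolutelyContinuousOnInterval (fun t => ∏ i ∈ s, F i t) a b := by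
  classical
  induction s using Finset.induction_on with
  | empty => simpa using absolutelyContinuousOnInterval_const (1 : ℝ) a b
  | insert i s hi ih =>
    simp only [Finset.prod_insert hi]
    exact (hF i (by simp)).fun_mul (ih fun j hj => hF j (by simp [hj]))

theorem absolutelyContinuousOnInterval_det {m : Type*} [Fintype m] [DecidableEq m]
    {Z : ℝ → Matrix m m ℝ} (hZ : ∀ i j, AbsolutelyContinuousOnInterval (fun t => Z t i j) a b) :
    AbsolutelyContinuousOnInterval (fun t => (Z t).det) a b := by
  simp only [Matrix.det_apply']
  exact absolutelyContinuousOnInterval_finset_sum _ fun σ _ =>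
    .const_mul _ (absolutelyContinuousOnInterval_finset_prod _ fun i _ => hZ _ _)

end AbsolutelyContinuous

section Gronwall

variable {u : ℝ → ℝ} {a b k : ℝ}

theorem le_of_ae_deriv_nonpos (hab : a ≤ b) (hu : AbsolutelyContinuousOnInterval u a b)
    (hderiv : ∀ᵐ t, t ∈ Ioo a b → deriv u t ≤ 0) : u b ≤ u a := by
  have h_int : ∫ t in a..b, deriv u t ≤ 0 := by
    rw [intervalIntegral.integral_of_le hab, integral_Ioc_eq_integral_Ioo]
    exact integral_nonpos_of_ae ((ae_restrict_iff' measurableSet_Ioo).2 hderiv)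
  linarith [hu.integral_deriv_eq_sub]

theorem le_exp_mul_of_ae_deriv_le (hab : a ≤ b) (hu : AbsolutelyContinuousOnInterval u a b)
    (hderiv : ∀ᵐ t, t ∈ Ioo a b → deriv u t ≤ k * u t) :
    u b ≤ Real.exp (k * (b - a)) * u a := by
  have hexp (t : ℝ) : HasDerivAt (fun t => Real.exp (k * (b - t)))
      (Real.exp (k * (b - t)) * -k) t := by
    simpa using (((hasDerivAt_id t).const_sub b).const_mul k).exp
  have hexp_ac : AbsolutelyContinuousOnInterval (fun t => Real.exp (k * (b - t))) a b :=
    ContDiffOn.absolutelyContinuousOnInterval (by fun_prop)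
  have hprod := le_of_ae_deriv_nonpos hab (hexp_ac.fun_mul hu) (by
    filter_upwards [hderiv, hu.ae_differentiableAt] with t ht hd hmem
    have hdiff := hd (uIcc_of_le hab ▸ Ioo_subset_Icc_self hmem)
    rw [((hexp t).fun_mul hdiff.hasDerivAt).deriv]
    calc Real.exp (k * (b - t)) * -k * u t + Real.exp (k * (b - t)) * deriv u t
        = Real.exp (k * (b - t)) * (deriv u t - k * u t) := by ring
      _ ≤ 0 := mul_nonpos_of_nonneg_of_nonpos (Real.exp_pos _).le (sub_nonpos.2 (ht hmem)))
  simpa using hprod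

theorem exp_mul_le_of_ae_le_deriv (hab : a ≤ b) (hu : AbsolutelyContinuousOnInterval u a b)
    (hderiv : ∀ᵐ t, t ∈ Ioo a b → k * u t ≤ deriv u t) :
    Real.exp (k * (b - a)) * u a ≤ u b := by
  have hneg := le_exp_mul_of_ae_deriv_le (k := k) hab hu.fun_neg (by
    filter_upwards [hderiv] with t ht hmem
    rw [deriv.fun_neg]
    linarith [ht hmem])
  linarith

theorem forall_lt_of_forall_Ico_lt {g : ℝ → ℝ} {c : ℝ} (hg : ContinuousOn g (Icc a b))
    (hstep : ∀ t ∈ Icc a b, (∀ s ∈ Ico a t, g s < c) → g t < c) : ∀ t ∈ Icc a b, g t < c := by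
  by_contra! hexit
  have hcompact : IsCompact (Icc a b ∩ g ⁻¹' Ici c) :=
    isCompact_Icc.of_isClosed_subset (hg.preimage_isClosed_of_isClosed isClosed_Icc isClosed_Ici)
      inter_subset_left
  obtain ⟨τ, ⟨hτ, hgτ⟩, hleast⟩ := hcompact.exists_isLeast hexit
  refine (hstep τ hτ fun s hs => ?_).not_ge hgτ
  by_contra! hgs
  exact hs.2.not_ge (hleast ⟨⟨hs.1, hs.2.le.trans hτ.2⟩, hgs⟩)

end Gronwall

section Seminorm

variable {E : Type*}

/-- A supporting functional of the seminorm `p` at `x`: a subgradient of `p` at `x`. Along a curve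
that passes through `x` it computes the derivative of `p`. -/
def IsSupportingFunctional [AddCommGroup E] [Module ℝ E] (p : Seminorm ℝ E) (x : E)
    (l : Module.Dual ℝ E) : Prop :=
  l x = p x ∧ ∀ y, |l y| ≤ p y

theorem exists_isSupportingFunctional [AddCommGroup E] [Module ℝ E] (p : Seminorm ℝ E) (x : E) :
    ∃ l, IsSupportingFunctional p x l := by
  rcases eq_or_ne x 0 with rfl | hx
  · exact ⟨0, by simp, by simp⟩
  let e := LinearEquiv.toSpanNonzeroSingleton ℝ E x hx
  have he (c : ℝ) : (e c : E) = c • x := rfl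
  obtain ⟨l, hl, hle⟩ := Module.Dual.exists_extension_of_le_seminorm_real
    (Submodule.span ℝ {x}) (p x • (e.symm : _ →ₗ[ℝ] ℝ)) (p := p) fun y => by
      obtain ⟨c, rfl⟩ := e.surjective y
      simpa [he, map_smul_eq_mul, mul_comm (p x)] using
        mul_le_mul_of_nonneg_right (le_abs_self c) (apply_nonneg p x)
  exact ⟨l, by simpa [he] using hl (e 1), hle⟩

variable [NormedAddCommGroup E] [NormedSpace ℝ E] [FiniteDimensional ℝ E] {p : Seminorm ℝ E}

theorem deriv_seminorm_comp_eq {z : ℝ → E} {w : E} {t : ℝ} (hz : HasDerivAt z w t)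
    (hp : DifferentiableAt ℝ (fun s => p (z s)) t) {l : Module.Dual ℝ E}
    (hl : IsSupportingFunctional p (z t) l) : deriv (fun s => p (z s)) t = l w := by
  have hlz : HasDerivAt (fun s => l (z s)) (l w) t :=
    (LinearMap.toContinuousLinearMap l).hasFDerivAt.comp_hasDerivAt t hz
  have hmin : IsLocalMin (fun s => p (z s) - l (z s)) t := .of_forall fun s => by
    simpa [hl.1] using (le_abs_self _).trans (hl.2 (z s))
  exact sub_eq_zero.1 (hmin.hasDerivAt_eq_zero (hp.hasDerivAt.sub hlz))

variable (p)

theorem continuous_seminorm : Continuous p :=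
  p.convexOn.locallyLipschitz.continuous

theorem exists_seminorm_le_mul_norm : ∃ C : ℝ, 0 < C ∧ ∀ x, p x ≤ C * ‖x‖ :=
  Seminorm.bound_of_continuous_normedSpace p (continuous_seminorm p)

theorem exists_lipschitzWith_seminorm : ∃ C : NNReal, LipschitzWith C p := by
  obtain ⟨C, -, hC⟩ := exists_seminorm_le_mul_norm p
  refine ⟨C.toNNReal, LipschitzWith.of_dist_le' fun x y => ?_⟩
  rw [Real.dist_eq, dist_eq_norm]
  exact (abs_sub_map_le_sub p x y).trans (hC _)

variable {p}

theorem exists_mul_norm_le_seminorm (hp : ∀ x, p x = 0 → x = 0) :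
    ∃ c : ℝ, 0 < c ∧ ∀ x, c * ‖x‖ ≤ p x := by
  obtain ⟨c, hc0, hc⟩ := (isCompact_sphere (0 : E) 1).exists_forall_le' (a := 0)
    (continuous_seminorm p).continuousOn fun x hx =>
      (apply_nonneg p x).lt_of_ne' fun h => ne_zero_of_mem_unit_sphere ⟨x, hx⟩ (hp x h)
  refine ⟨c, hc0, fun x => ?_⟩
  rcases eq_or_ne x 0 with rfl | hx
  · simp
  have hunit := hc (‖x‖⁻¹ • x) (by simp [norm_smul, hx])
  rwa [map_smul_eq_mul, norm_inv, norm_norm, inv_mul_eq_div,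
    le_div_iff₀ (norm_pos_iff.2 hx)] at hunit

theorem isBounded_seminorm_lt (hp : ∀ x, p x = 0 → x = 0) (ε : ℝ) :
    Bornology.IsBounded {x | p x < ε} := by
  obtain ⟨c, hc0, hc⟩ := exists_mul_norm_le_seminorm hp
  refine isBounded_iff_forall_norm_le.2 ⟨ε / c, fun x hx => ?_⟩
  rw [le_div_iff₀ hc0, mul_comm]
  exact (hc x).trans (le_of_lt hx)

end Seminorm

section MatrixMeasure

variable {n : ℕ} {M : Seminorm ℝ (Fin n → ℝ)} {A : Matrix (Fin n) (Fin n) ℝ}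

theorem bddAbove_inducedNorm (hM : ∀ x, M x = 0 → x = 0) (A : Matrix (Fin n) (Fin n) ℝ) :
    BddAbove ((fun v : Fin n → ℝ => M (A.mulVec v)) '' {v | M v ≤ 1}) := by
  obtain ⟨c, hc0, hc⟩ := exists_mul_norm_le_seminorm hM
  obtain ⟨C, hC0, hC⟩ := exists_seminorm_le_mul_norm (M.comp A.mulVecLin)
  refine ⟨C * c⁻¹, ?_⟩
  rintro _ ⟨v, hv, rfl⟩
  refine (hC v).trans (mul_le_mul_of_nonneg_left ?_ hC0.le)
  rw [← mul_one c⁻¹, le_inv_mul_iff₀ hc0]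
  exact (hc v).trans hv

theorem le_inducedNorm_mul (hM : ∀ x, M x = 0 → x = 0) (A : Matrix (Fin n) (Fin n) ℝ)
    (v : Fin n → ℝ) : M (A.mulVec v) ≤ inducedNorm M A * M v := by
  rcases eq_or_ne (M v) 0 with hv | hv
  · simp [hM v hv]
  have hpos : 0 < M v := (apply_nonneg M v).lt_of_ne' hv
  have hunit : M (A.mulVec ((M v)⁻¹ • v)) ≤ inducedNorm M A :=
    le_csSup (bddAbove_inducedNorm hM A)
      ⟨_, by simp [map_smul_eq_mul, abs_of_pos hpos, hv], rfl⟩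
  rwa [Matrix.mulVec_smul, map_smul_eq_mul, norm_inv, Real.norm_of_nonneg hpos.le, inv_mul_eq_div,
    div_le_iff₀ hpos] at hunit

theorem inducedNorm_le {r : ℝ} (h : ∀ v, M v ≤ 1 → M (A.mulVec v) ≤ r) : inducedNorm M A ≤ r :=
  csSup_le ⟨_, 0, by simp, rfl⟩ (forall_mem_image.2 h)

theorem inducedNorm_nonneg (M : Seminorm ℝ (Fin n → ℝ)) (A : Matrix (Fin n) (Fin n) ℝ) :
    0 ≤ inducedNorm M A :=
  Real.sSup_nonneg (forall_mem_image.2 fun _ _ => apply_nonneg M _)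

theorem inducedNorm_one_add_smul_le (hM : ∀ x, M x = 0 → x = 0) (A : Matrix (Fin n) (Fin n) ℝ)
    {q : ℝ} (hq0 : 0 ≤ q) (hq1 : q ≤ 1) :
    inducedNorm M (1 + q • A) ≤ 1 - q + q * inducedNorm M (1 + A) := by
  refine inducedNorm_le fun v hv => ?_
  have hcombo : (1 + q • A).mulVec v = (1 - q) • v + q • (1 + A).mulVec v := by
    simp only [Matrix.add_mulVec, Matrix.one_mulVec, Matrix.smul_mulVec]
    module
  have hA : M ((1 + A).mulVec v) ≤ inducedNorm M (1 + A) :=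
    (le_inducedNorm_mul hM _ v).trans (mul_le_of_le_one_right (inducedNorm_nonneg M _) hv)
  calc M ((1 + q • A).mulVec v) ≤ (1 - q) * M v + q * M ((1 + A).mulVec v) := by
        rw [hcombo]
        refine (map_add_le_add M _ _).trans_eq ?_
        rw [map_smul_eq_mul, map_smul_eq_mul, Real.norm_of_nonneg hq0,
          Real.norm_of_nonneg (sub_nonneg.2 hq1)]
    _ ≤ 1 - q + q * inducedNorm M (1 + A) := by
        gcongr
        exact mul_le_of_le_one_right (sub_nonneg.2 hq1) hv

theorem one_sub_mul_inducedNorm_le (hn : 0 < n) (hM : ∀ x, M x = 0 → x = 0)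
    (A : Matrix (Fin n) (Fin n) ℝ) {s : ℝ} (hs : 0 ≤ s) :
    1 - s * inducedNorm M A ≤ inducedNorm M (1 + s • A) := by
  have : Nonempty (Fin n) := ⟨⟨0, hn⟩⟩
  obtain ⟨v, hv⟩ := exists_ne (0 : Fin n → ℝ)
  have hpos : 0 < M v := (apply_nonneg M v).lt_of_ne' fun h => hv (hM v h)
  have hv_eq : v = (1 + s • A).mulVec v - s • A.mulVec v := by
    simp [Matrix.add_mulVec, Matrix.smul_mulVec]
  have htriangle : M v ≤ inducedNorm M (1 + s • A) * M v + s * (inducedNorm M A * M v) :=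
    calc M v = M ((1 + s • A).mulVec v - s • A.mulVec v) := congrArg M hv_eq
      _ ≤ M ((1 + s • A).mulVec v) + M (s • A.mulVec v) := map_sub_le_add M _ _
      _ ≤ inducedNorm M (1 + s • A) * M v + s * (inducedNorm M A * M v) := by
        rw [map_smul_eq_mul, Real.norm_of_nonneg hs]
        gcongr <;> exact le_inducedNorm_mul hM _ v
  refine le_of_mul_le_mul_right ?_ hpos
  linarith

theorem monotoneOn_inducedNorm_sub_one_div (hM : ∀ x, M x = 0 → x = 0)
    (A : Matrix (Fin n) (Fin n) ℝ) :
    MonotoneOn (fun s : ℝ => (inducedNorm M (1 + s • A) - 1) / s) (Ioi 0) := by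
  intro s (hs : 0 < s) t (ht : 0 < t) hst
  have hconv := inducedNorm_one_add_smul_le hM (t • A) (div_nonneg hs.le ht.le)
    ((div_le_one ht).2 hst)
  rw [smul_smul, div_mul_cancel₀ s ht.ne'] at hconv
  calc (inducedNorm M (1 + s • A) - 1) / s
      ≤ (s / t * (inducedNorm M (1 + t • A) - 1)) / s := by gcongr; linarith
    _ = (inducedNorm M (1 + t • A) - 1) / t := by field_simp

theorem tendsto_matrixMeasure (hn : 0 < n) (hM : ∀ x, M x = 0 → x = 0)
    (A : Matrix (Fin n) (Fin n) ℝ) :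
    Tendsto (fun s : ℝ => (inducedNorm M (1 + s • A) - 1) / s) (𝓝[>] 0)
      (𝓝 (matrixMeasure M A)) := by
  refine tendsto_nhds_limUnder
    ⟨_, (monotoneOn_inducedNorm_sub_one_div hM A).tendsto_nhdsGT ⟨-inducedNorm M A, ?_⟩⟩
  rintro _ ⟨s, hs : 0 < s, rfl⟩
  rw [le_div_iff₀ hs]
  linarith [one_sub_mul_inducedNorm_le hn hM A hs.le]

theorem IsSupportingFunctional.mulVec_le_matrixMeasure_mul (hM : ∀ x, M x = 0 → x = 0)
    (A : Matrix (Fin n) (Fin n) ℝ) {z : Fin n → ℝ} {l : Module.Dual ℝ (Fin n → ℝ)}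
    (hl : IsSupportingFunctional M z l) : l (A.mulVec z) ≤ matrixMeasure M A * M z := by
  rcases eq_or_ne z 0 with rfl | hz
  · simp
  obtain ⟨i, -⟩ := Function.ne_iff.1 hz
  refine ge_of_tendsto ((tendsto_matrixMeasure i.pos hM A).mul_const (M z)) ?_
  filter_upwards [self_mem_nhdsWithin] with s (hs : 0 < s)
  have hbound : M z + s * l (A.mulVec z) ≤ inducedNorm M (1 + s • A) * M z :=
    calc M z + s * l (A.mulVec z) = l ((1 + s • A).mulVec z) := by
          simp [Matrix.add_mulVec, Matrix.smul_mulVec, hl.1]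
      _ ≤ M ((1 + s • A).mulVec z) := (le_abs_self _).trans (hl.2 _)
      _ ≤ inducedNorm M (1 + s • A) * M z := le_inducedNorm_mul hM _ z
  rw [div_mul_eq_mul_div, le_div_iff₀ hs]
  linarith

end MatrixMeasure

section Liouville

variable {m : Type*} [Fintype m] [DecidableEq m] {Z : ℝ → Matrix m m ℝ}

theorem hasDerivAt_det_of_eq_mul {A : Matrix m m ℝ} {t : ℝ}
    (hZ : ∀ i j, HasDerivAt (fun s => Z s i j) ((A * Z t) i j) t) :
    HasDerivAt (fun s => (Z s).det) (A.trace * (Z t).det) t := by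
  let D : ContinuousMultilinearMap ℝ (fun _ : m => m → ℝ) ℝ :=
    ⟨(Matrix.detRowAlternating (R := ℝ) (n := m)).toMultilinearMap,
      (continuous_id.matrix_det : Continuous fun B : Matrix m m ℝ => B.det)⟩
  have hrow : HasDerivAt (fun s i => Z s i) (fun i => (A * Z t) i) t :=
    hasDerivAt_pi.2 fun i => hasDerivAt_pi.2 (hZ i)
  have htrace : D.linearDeriv (fun i => Z t i) (fun i => (A * Z t) i) = A.trace * (Z t).det := by
    rw [ContinuousMultilinearMap.linearDeriv_apply, Matrix.trace, Finset.sum_mul]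
    refine Finset.sum_congr rfl fun i _ => ?_
    have hrow_i : (A * Z t) i = ∑ k, A i k • Z t k := by
      ext j
      simp [Matrix.mul_apply, Finset.sum_apply]
    rw [hrow_i]
    exact Matrix.det_updateRow_sum (Z t) i (A i)
  rw [← htrace]
  exact (D.hasFDerivAt (fun i => Z t i)).comp_hasDerivAt t hrow

theorem exp_mul_abs_det_le {A : ℝ → Matrix m m ℝ} {a b k : ℝ} (hab : a ≤ b)
    (hZ : ∀ i j, AbsolutelyContinuousOnInterval (fun t => Z t i j) a b)
    (hderiv : ∀ᵐ t, t ∈ Ioo a b → ∀ i j, HasDerivAt (fun s => Z s i j) ((A t * Z t) i j) t)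
    (hA : ∀ t ∈ Ioo a b, k ≤ (A t).trace) :
    Real.exp (k * (b - a)) * |(Z a).det| ≤ |(Z b).det| := by
  have hdet := absolutelyContinuousOnInterval_det hZ
  have hsq : Real.exp (2 * k * (b - a)) * ((Z a).det * (Z a).det) ≤ (Z b).det * (Z b).det :=
    exp_mul_le_of_ae_le_deriv hab (hdet.fun_mul hdet) (by
      filter_upwards [hderiv] with t ht hmem
      have hdet_deriv := hasDerivAt_det_of_eq_mul (ht hmem)
      rw [(hdet_deriv.fun_mul hdet_deriv).deriv]
      nlinarith [mul_le_mul_of_nonneg_right (hA t hmem) (mul_self_nonneg (Z t).det)])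
  have hexp : Real.exp (2 * k * (b - a)) = Real.exp (k * (b - a)) ^ 2 := by
    rw [← Real.exp_nat_mul, Nat.cast_ofNat, mul_assoc]
  rw [hexp, ← sq, ← sq, ← mul_pow, sq_le_sq, abs_mul, Real.abs_exp] at hsq
  exact hsq

end Liouville

section Solutions

variable {n : ℕ} {f : ℝ → (Fin n → ℝ) → (Fin n → ℝ)} {t₀ : ℝ}

theorem isSolution_flow (hf : ForwardComplete f t₀) (x : Fin n → ℝ) :
    IsSolution f t₀ x (fun t => flow f t₀ t x) :=
  Classical.epsilon_spec (hf x)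

variable {x y : Fin n → ℝ} {φ ψ : ℝ → Fin n → ℝ} {a b : ℝ}

theorem IsSolution.apply_initial (hφ : IsSolution f t₀ x φ) : φ t₀ = x := by
  simpa using (hφ t₀ le_rfl).2

theorem flow_self (hf : ForwardComplete f t₀) (x : Fin n → ℝ) : flow f t₀ t₀ x = x :=
  (isSolution_flow hf x).apply_initial

theorem IsSolution.intervalIntegrable (hφ : IsSolution f t₀ x φ) (ha : t₀ ≤ a) (hb : t₀ ≤ b) :
    IntervalIntegrable (fun s => f s (φ s)) volume a b :=
  (hφ a ha).1.symm.trans (hφ b hb).1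

theorem IsSolution.sub_eq_integral (hφ : IsSolution f t₀ x φ) (ha : t₀ ≤ a) (hb : t₀ ≤ b) :
    φ b - φ a = ∫ s in a..b, f s (φ s) := by
  rw [(hφ a ha).2, (hφ b hb).2,
    ← intervalIntegral.integral_add_adjacent_intervals (hφ a ha).1 (hφ.intervalIntegrable ha hb)]
  abel

theorem IsSolution.absolutelyContinuousOnInterval (hφ : IsSolution f t₀ x φ) (ha : t₀ ≤ a)
    (hb : t₀ ≤ b) : AbsolutelyContinuousOnInterval φ a b := by
  have hint := hφ.intervalIntegrable ha hb
  refine absolutelyContinuousOnInterval_pi fun i => ?_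
  let π : (Fin n → ℝ) →L[ℝ] ℝ := ContinuousLinearMap.proj i
  have hint_i : IntervalIntegrable (fun s => π (f s (φ s))) volume a b :=
    ⟨π.integrable_comp hint.1, π.integrable_comp hint.2⟩
  refine absolutelyContinuousOnInterval_of_dist_le_mul (C := 1)
    (hint_i.absolutelyContinuousOnInterval_intervalIntegral left_mem_uIcc) fun s hs t ht => ?_
  have hs0 : t₀ ≤ s := (le_min ha hb).trans hs.1
  have ht0 : t₀ ≤ t := (le_min ha hb).trans ht.1
  rw [π.intervalIntegral_comp_comm (hφ.intervalIntegrable ha hs0),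
    π.intervalIntegral_comp_comm (hφ.intervalIntegrable ha ht0), ← hφ.sub_eq_integral ha hs0,
    ← hφ.sub_eq_integral ha ht0]
  simp [π]

theorem IsSolution.ae_hasDerivAt (hφ : IsSolution f t₀ x φ) :
    ∀ᵐ t, t₀ < t → HasDerivAt φ (f t (φ t)) t := by
  have hnat : ∀ᵐ t, ∀ k : ℕ, t ∈ uIcc t₀ (t₀ + k) →
      HasDerivAt (fun s => ∫ r in t₀..s, f r (φ r)) (f t (φ t)) t := by
    refine ae_all_iff.2 fun k => ?_
    filter_upwards [(hφ (t₀ + k) (by simp)).1.ae_hasDerivAt_integral] with t ht hmem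
    exact ht hmem t₀ left_mem_uIcc
  filter_upwards [hnat] with t ht hlt
  obtain ⟨k, hk⟩ := exists_nat_ge (t - t₀)
  refine ((ht k (mem_uIcc_of_le hlt.le (by linarith))).const_add x).congr_of_eventuallyEq ?_
  filter_upwards [Ioi_mem_nhds hlt] with s (hs : t₀ < s)
  exact (hφ s hs.le).2

theorem IsSolution.absolutelyContinuousOnInterval_seminorm_sub (hφ : IsSolution f t₀ x φ)
    (hψ : IsSolution f t₀ y ψ) (p : Seminorm ℝ (Fin n → ℝ)) (ha : t₀ ≤ a) (hb : t₀ ≤ b) :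
    AbsolutelyContinuousOnInterval (fun t => p (φ t - ψ t)) a b := by
  obtain ⟨C, hC⟩ := exists_lipschitzWith_seminorm p
  exact absolutelyContinuousOnInterval_of_dist_le_mul
    ((hφ.absolutelyContinuousOnInterval ha hb).fun_sub (hψ.absolutelyContinuousOnInterval ha hb))
    fun s _ t _ => hC.dist_le_mul _ _

theorem IsSolution.ae_deriv_seminorm_sub_eq (hφ : IsSolution f t₀ x φ)
    (hψ : IsSolution f t₀ y ψ) (p : Seminorm ℝ (Fin n → ℝ)) (ha : t₀ ≤ a) :
    ∀ᵐ t, t ∈ Ioo a b → ∀ l, IsSupportingFunctional p (φ t - ψ t) l →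
      deriv (fun t => p (φ t - ψ t)) t = l (f t (φ t) - f t (ψ t)) := by
  rcases le_or_gt a b with hab | hab
  · filter_upwards [hφ.ae_hasDerivAt, hψ.ae_hasDerivAt,
      (hφ.absolutelyContinuousOnInterval_seminorm_sub hψ p ha (ha.trans hab)).ae_differentiableAt]
      with t hφt hψt hpt hmem l hl
    have ht : t₀ < t := ha.trans_lt hmem.1
    exact deriv_seminorm_comp_eq ((hφt ht).fun_sub (hψt ht))
      (hpt (uIcc_of_le hab ▸ Ioo_subset_Icc_self hmem)) hl
  · simp [Ioo_eq_empty_of_le hab.le]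

theorem IsSolution.seminorm_sub_le (hφ : IsSolution f t₀ x φ) (hψ : IsSolution f t₀ y ψ)
    (p : Seminorm ℝ (Fin n → ℝ)) (ha : t₀ ≤ a) (hab : a ≤ b) {k : ℝ}
    (hk : ∀ t ∈ Ioo a b, ∀ l, IsSupportingFunctional p (φ t - ψ t) l →
      l (f t (φ t) - f t (ψ t)) ≤ k * p (φ t - ψ t)) :
    p (φ b - ψ b) ≤ Real.exp (k * (b - a)) * p (φ a - ψ a) := by
  refine le_exp_mul_of_ae_deriv_le hab
    (hφ.absolutelyContinuousOnInterval_seminorm_sub hψ p ha (ha.trans hab)) ?_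
  filter_upwards [hφ.ae_deriv_seminorm_sub_eq hψ p ha] with t ht hmem
  obtain ⟨l, hl⟩ := exists_isSupportingFunctional p (φ t - ψ t)
  exact (ht hmem l hl).trans_le (hk t hmem l hl)

theorem IsSolution.norm_sub_le (hφ : IsSolution f t₀ x φ) (hψ : IsSolution f t₀ y ψ)
    (ha : t₀ ≤ a) (hab : a ≤ b) {L : ℝ}
    (hL : ∀ t ∈ Ioo a b, ‖f t (φ t) - f t (ψ t)‖ ≤ L * ‖φ t - ψ t‖) :
    ‖φ b - ψ b‖ ≤ Real.exp (L * (b - a)) * ‖φ a - ψ a‖ :=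
  hφ.seminorm_sub_le hψ (normSeminorm ℝ (Fin n → ℝ)) ha hab fun t ht _ hl =>
    ((le_abs_self _).trans (hl.2 _)).trans (hL t ht)

theorem IsSolution.le_norm_sub (hφ : IsSolution f t₀ x φ) (hψ : IsSolution f t₀ y ψ)
    (ha : t₀ ≤ a) (hab : a ≤ b) {L : ℝ}
    (hL : ∀ t ∈ Ioo a b, ‖f t (φ t) - f t (ψ t)‖ ≤ L * ‖φ t - ψ t‖) :
    Real.exp (-L * (b - a)) * ‖φ a - ψ a‖ ≤ ‖φ b - ψ b‖ := by
  let p := normSeminorm ℝ (Fin n → ℝ)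
  refine exp_mul_le_of_ae_le_deriv hab
    (hφ.absolutelyContinuousOnInterval_seminorm_sub hψ p ha (ha.trans hab)) ?_
  filter_upwards [hφ.ae_deriv_seminorm_sub_eq hψ p ha] with t ht hmem
  obtain ⟨l, hl⟩ := exists_isSupportingFunctional p (φ t - ψ t)
  rw [ht hmem l hl, neg_mul]
  exact (neg_le_neg ((hl.2 _).trans (hL t hmem))).trans (neg_abs_le _)

end Solutions

section Flow

variable {n : ℕ} {f : ℝ → (Fin n → ℝ) → (Fin n → ℝ)} {t₀ : ℝ}

theorem fderiv_apply_eq_jacobian_mulVec (f : ℝ → (Fin n → ℝ) → (Fin n → ℝ)) (t : ℝ)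
    (v w : Fin n → ℝ) : fderiv ℝ (f t) v w = (jacobian f t v).mulVec w := by
  rw [jacobian, LinearMap.toMatrix'_mulVec, ContinuousLinearMap.coe_coe]

theorem norm_fderiv_le_of_abs_jacobian_le {t C : ℝ} {v : Fin n → ℝ} (hC0 : 0 ≤ C)
    (hC : ∀ i j, |jacobian f t v i j| ≤ C) : ‖fderiv ℝ (f t) v‖ ≤ n * C := by
  refine ContinuousLinearMap.opNorm_le_bound _ (by positivity) fun w => ?_
  rw [fderiv_apply_eq_jacobian_mulVec]
  refine (pi_norm_le_iff_of_nonneg (by positivity)).2 fun i => ?_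
  calc ‖∑ j, jacobian f t v i j * w j‖ ≤ ∑ j, |jacobian f t v i j| * |w j| := by
        simpa only [Real.norm_eq_abs, abs_mul] using
          norm_sum_le Finset.univ fun j => jacobian f t v i j * w j
    _ ≤ ∑ _j : Fin n, C * ‖w‖ := by
        gcongr with j
        · exact hC i j
        · exact norm_le_pi_norm w j
    _ = n * C * ‖w‖ := by simp [mul_assoc]

/-- `f(t, ·)` is Lipschitz on every ball, with a constant that is uniform for `t` in a bounded
interval: the form in which a bound on the Jacobian yields bounds on the flow. -/
def LocallyLipschitzInState (f : ℝ → (Fin n → ℝ) → (Fin n → ℝ)) (t₀ : ℝ) : Prop :=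
  ∀ T R : ℝ, ∃ L : NNReal, ∀ t ∈ Icc t₀ T, LipschitzOnWith L (f t) (Metric.closedBall 0 R)

theorem JacobianLocallyBounded.locallyLipschitzInState (hf_bdd : JacobianLocallyBounded f t₀)
    (hf_diff : ∀ t, t₀ ≤ t → Differentiable ℝ (f t)) : LocallyLipschitzInState f t₀ := by
  intro T R
  obtain ⟨C, hC⟩ := hf_bdd T R
  refine ⟨(n * |C|).toNNReal, fun t ht => ?_⟩
  refine (convex_closedBall 0 R).lipschitzOnWith_of_nnnorm_fderiv_le (𝕜 := ℝ)
    (fun v _ => hf_diff t ht.1 v) fun v hv => ?_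
  rw [← NNReal.coe_le_coe, coe_nnnorm, Real.coe_toNNReal _ (by positivity)]
  exact norm_fderiv_le_of_abs_jacobian_le (abs_nonneg C) fun i j =>
    (hC t ht v (mem_closedBall_zero_iff.1 hv) i j).trans (le_abs_self C)

variable (hf : ForwardComplete f t₀) (hf_lip : LocallyLipschitzInState f t₀)

include hf hf_lip

theorem exists_eventually_norm_flow_le (T : ℝ) (x : Fin n → ℝ) :
    ∃ R : ℝ, ∀ᶠ y in 𝓝 x, ∀ t ∈ Icc t₀ T, ‖flow f t₀ t y‖ ≤ R := by
  have hcont (y : Fin n → ℝ) : ContinuousOn (fun t => flow f t₀ t y) (Icc t₀ T) := by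
    rcases le_or_gt t₀ T with hT | hT
    · exact uIcc_of_le hT ▸
        ((isSolution_flow hf y).absolutelyContinuousOnInterval le_rfl hT).continuousOn
    · simp [Icc_eq_empty_of_lt hT]
  obtain ⟨R, hR⟩ := isCompact_Icc.exists_bound_of_continuousOn (hcont x)
  obtain ⟨L, hL⟩ := hf_lip T (R + 1)
  refine ⟨R + 1, ?_⟩
  filter_upwards [Metric.ball_mem_nhds x (Real.exp_pos (-(L * (T - t₀))))] with y hy
  have hnear {t : ℝ} (ht : t ∈ Icc t₀ T) (hxy : ‖flow f t₀ t y - flow f t₀ t x‖ < 1) :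
      ‖flow f t₀ t y‖ ≤ R + 1 :=
    (norm_le_norm_add_norm_sub' _ _).trans (add_le_add (hR t ht) hxy.le)
  refine fun t ht => hnear ht (forall_lt_of_forall_Ico_lt ((hcont y).sub (hcont x)).norm
    (fun τ hτ hbefore => ?_) t ht)
  calc ‖flow f t₀ τ y - flow f t₀ τ x‖
      ≤ Real.exp (L * (τ - t₀)) * ‖flow f t₀ t₀ y - flow f t₀ t₀ x‖ := by
        refine (isSolution_flow hf y).norm_sub_le (isSolution_flow hf x) le_rfl hτ.1 fun s hs => ?_
        have hs' : s ∈ Icc t₀ T := ⟨hs.1.le, hs.2.le.trans hτ.2⟩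
        exact (hL s hs').norm_sub_le
          (mem_closedBall_zero_iff.2 (hnear hs' (hbefore s ⟨hs.1.le, hs.2⟩)))
          (mem_closedBall_zero_iff.2 (by linarith [hR s hs']))
    _ < Real.exp (L * (τ - t₀)) * Real.exp (-(L * (T - t₀))) := by
        rw [flow_self hf, flow_self hf]
        gcongr
        rwa [← dist_eq_norm]
    _ ≤ 1 := by
        rw [← Real.exp_add, Real.exp_le_one_iff]
        nlinarith [hτ.2, L.coe_nonneg]

theorem exists_norm_flow_le (T r : ℝ) :
    ∃ R : ℝ, ∀ x ∈ Metric.closedBall 0 r, ∀ t ∈ Icc t₀ T, ‖flow f t₀ t x‖ ≤ R := by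
  refine (isCompact_closedBall (0 : Fin n → ℝ) r).induction_on ⟨0, by simp⟩
    (fun s s' hs ⟨R, hR⟩ => ⟨R, fun x hx => hR x (hs hx)⟩) ?_ fun x _ => ?_
  · rintro s s' ⟨R, hR⟩ ⟨R', hR'⟩
    exact ⟨max R R', fun x hx t ht => hx.elim (fun hx => (hR x hx t ht).trans (le_max_left _ _))
      fun hx => (hR' x hx t ht).trans (le_max_right _ _)⟩
  · obtain ⟨R, hR⟩ := exists_eventually_norm_flow_le hf hf_lip T x
    exact ⟨_, mem_nhdsWithin_of_mem_nhds hR, R, fun y hy => hy⟩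

theorem exists_norm_apply_flow_sub_le (T r : ℝ) :
    ∃ L : NNReal, ∀ x ∈ Metric.closedBall 0 r, ∀ y ∈ Metric.closedBall 0 r, ∀ t ∈ Icc t₀ T,
      ‖f t (flow f t₀ t x) - f t (flow f t₀ t y)‖ ≤ L * ‖flow f t₀ t x - flow f t₀ t y‖ := by
  obtain ⟨R, hR⟩ := exists_norm_flow_le hf hf_lip T r
  obtain ⟨L, hL⟩ := hf_lip T R
  exact ⟨L, fun x hx y hy t ht => (hL t ht).norm_sub_le
    (mem_closedBall_zero_iff.2 (hR x hx t ht)) (mem_closedBall_zero_iff.2 (hR y hy t ht))⟩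

theorem exists_lipschitzOnWith_flow (T r : ℝ) :
    ∃ C : NNReal, ∀ t ∈ Icc t₀ T, LipschitzOnWith C (flow f t₀ t) (Metric.closedBall 0 r) := by
  obtain ⟨L, hL⟩ := exists_norm_apply_flow_sub_le hf hf_lip T r
  refine ⟨⟨Real.exp (L * (T - t₀)), (Real.exp_pos _).le⟩, fun t ht => ?_⟩
  refine LipschitzOnWith.of_dist_le_mul fun x hx y hy => ?_
  rw [dist_eq_norm, dist_eq_norm]
  calc ‖flow f t₀ t x - flow f t₀ t y‖ ≤ Real.exp (L * (t - t₀)) * ‖x - y‖ := by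
        simpa only [flow_self hf] using (isSolution_flow hf x).norm_sub_le (isSolution_flow hf y)
          le_rfl ht.1 fun s hs => hL x hx y hy s ⟨hs.1.le, hs.2.le.trans ht.2⟩
    _ ≤ Real.exp (L * (T - t₀)) * ‖x - y‖ := by
        gcongr
        exact ht.2

theorem injective_flow {T : ℝ} (hT : t₀ ≤ T) : Function.Injective (flow f t₀ T) := by
  intro x y hxy
  obtain ⟨L, hL⟩ := exists_norm_apply_flow_sub_le hf hf_lip T (max ‖x‖ ‖y‖)
  have hsub := (isSolution_flow hf x).le_norm_sub (isSolution_flow hf y) le_rfl hT fun t ht =>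
    hL x (by simp) y (by simp) t (Ioo_subset_Icc_self ht)
  rw [flow_self hf, flow_self hf, hxy, sub_self, norm_zero] at hsub
  exact sub_eq_zero.1 (norm_le_zero_iff.1 (nonpos_of_mul_nonpos_right hsub (Real.exp_pos _)))

end Flow

section Contraction

variable {n : ℕ} {f : ℝ → (Fin n → ℝ) → (Fin n → ℝ)} {t₀ : ℝ} {M : Seminorm ℝ (Fin n → ℝ)}
  {K : Set (Fin n → ℝ)} {c : ℝ}

theorem exists_mem_segment_map_sub_eq {t : ℝ} (hf_diff : Differentiable ℝ (f t))
    (l : Module.Dual ℝ (Fin n → ℝ)) (x y : Fin n → ℝ) :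
    ∃ v ∈ segment ℝ y x, l (f t x - f t y) = l ((jacobian f t v).mulVec (x - y)) := by
  obtain ⟨v, hv, hmvt⟩ := domain_mvt (f := fun v => l (f t v)) (x := y) (y := x)
    (fun v _ => ((LinearMap.toContinuousLinearMap l).hasFDerivAt.comp v
      (hf_diff v).hasFDerivAt).hasFDerivWithinAt) convex_univ (mem_univ y) (mem_univ x)
  refine ⟨v, hv, ?_⟩
  rw [map_sub, hmvt, ← fderiv_apply_eq_jacobian_mulVec]
  rfl

theorem IsSolution.seminorm_sub_le_of_matrixMeasure_le {x y : Fin n → ℝ} {φ ψ : ℝ → Fin n → ℝ}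
    (hφ : IsSolution f t₀ x φ) (hψ : IsSolution f t₀ y ψ) (hM : ∀ x, M x = 0 → x = 0) {a b : ℝ}
    (ha : t₀ ≤ a) (hab : a ≤ b) (hf_diff : ∀ t ∈ Ioo a b, Differentiable ℝ (f t))
    (hc : ∀ t ∈ Ioo a b, ∀ v ∈ segment ℝ (ψ t) (φ t), matrixMeasure M (jacobian f t v) ≤ c) :
    M (φ b - ψ b) ≤ Real.exp (c * (b - a)) * M (φ a - ψ a) := by
  refine hφ.seminorm_sub_le hψ M ha hab fun t ht l hl => ?_
  obtain ⟨v, hv, hmvt⟩ := exists_mem_segment_map_sub_eq (hf_diff t ht) l (φ t) (ψ t)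
  rw [hmvt]
  exact (hl.mulVec_le_matrixMeasure_mul hM _).trans
    (mul_le_mul_of_nonneg_right (hc t ht v hv) (apply_nonneg M _))

theorem IsSolution.norm_sub_le_of_matrixMeasure_le {x y : Fin n → ℝ} {φ ψ : ℝ → Fin n → ℝ}
    (hφ : IsSolution f t₀ x φ) (hψ : IsSolution f t₀ y ψ) {d D : ℝ} (hd0 : 0 < d)
    (hd : ∀ v, d * ‖v‖ ≤ M v) (hD : ∀ v, M v ≤ D * ‖v‖) {a b : ℝ} (ha : t₀ ≤ a) (hab : a ≤ b)
    (hf_diff : ∀ t ∈ Ioo a b, Differentiable ℝ (f t))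
    (hc : ∀ t ∈ Ioo a b, ∀ v ∈ segment ℝ (ψ t) (φ t), matrixMeasure M (jacobian f t v) ≤ c) :
    ‖φ b - ψ b‖ ≤ D / d * Real.exp (c * (b - a)) * ‖φ a - ψ a‖ := by
  have hM (v : Fin n → ℝ) (hv : M v = 0) : v = 0 :=
    norm_le_zero_iff.1 (nonpos_of_mul_nonpos_right ((hd v).trans_eq hv) hd0)
  calc ‖φ b - ψ b‖ ≤ M (φ b - ψ b) / d := (le_div_iff₀' hd0).2 (hd _)
    _ ≤ Real.exp (c * (b - a)) * (D * ‖φ a - ψ a‖) / d := by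
      gcongr
      refine (hφ.seminorm_sub_le_of_matrixMeasure_le hψ hM ha hab hf_diff hc).trans ?_
      gcongr
      exact hD _
    _ = D / d * Real.exp (c * (b - a)) * ‖φ a - ψ a‖ := by ring

theorem exists_matrixMeasure_le_of_muHat_lt (h : muHat M f t₀ K < c) :
    ∃ τ, t₀ ≤ τ ∧ ∀ t, τ ≤ t → ∀ v ∈ convexHull ℝ (reachableSet f t₀ t K),
      matrixMeasure M (jacobian f t v) ≤ c := by
  obtain ⟨τ, hτ⟩ := eventually_atTop.1 (eventually_lt_of_limsup_lt h)
  refine ⟨max τ t₀, le_max_right _ _, fun t ht v hv => EReal.coe_le_coe_iff.1 ?_⟩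
  exact (le_iSup₂ (f := fun v _ => (matrixMeasure M (jacobian f t v) : EReal)) v hv).trans
    (hτ t ((le_max_left _ _).trans ht)).le

theorem exists_norm_flow_sub_le_exp (hM : ∀ x, M x = 0 → x = 0)
    (hf_diff : ∀ t, t₀ ≤ t → Differentiable ℝ (f t)) (hf : ForwardComplete f t₀)
    (hf_lip : LocallyLipschitzInState f t₀) (hK : Bornology.IsBounded K) (hc : 0 ≤ c)
    (h : muHat M f t₀ K < c) :
    ∃ B : ℝ, ∀ x ∈ K, ∀ y ∈ K, ∀ t, t₀ ≤ t →
      ‖flow f t₀ t x - flow f t₀ t y‖ ≤ B * Real.exp (c * (t - t₀)) * ‖x - y‖ := by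
  obtain ⟨τ, hτ0, hτ⟩ := exists_matrixMeasure_le_of_muHat_lt h
  obtain ⟨r, hr⟩ := hK.subset_closedBall 0
  obtain ⟨C, hC⟩ := exists_lipschitzOnWith_flow hf hf_lip τ r
  obtain ⟨D, -, hD⟩ := exists_seminorm_le_mul_norm M
  obtain ⟨d, hd0, hd⟩ := exists_mul_norm_le_seminorm hM
  refine ⟨max 1 (D / d) * C, fun x hx y hy t ht => ?_⟩
  have hinitial : ‖flow f t₀ (min t τ) x - flow f t₀ (min t τ) y‖ ≤ C * ‖x - y‖ :=
    (hC _ ⟨le_min ht hτ0, min_le_right _ _⟩).norm_sub_le (hr hx) (hr hy)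
  have hexp : 1 ≤ Real.exp (c * (t - t₀)) :=
    Real.one_le_exp (mul_nonneg hc (sub_nonneg.2 ht))
  suffices hlate : ‖flow f t₀ t x - flow f t₀ t y‖ ≤ max 1 (D / d) * Real.exp (c * (t - t₀)) *
      ‖flow f t₀ (min t τ) x - flow f t₀ (min t τ) y‖ by
    calc _ ≤ max 1 (D / d) * Real.exp (c * (t - t₀)) * (C * ‖x - y‖) := hlate.trans (by gcongr)
      _ = _ := by ring
  rcases le_total t τ with htτ | htτ
  · rw [min_eq_left htτ]
    exact le_mul_of_one_le_left (norm_nonneg _)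
      (one_le_mul_of_one_le_of_one_le (le_max_left _ _) hexp)
  rw [min_eq_right htτ]
  calc ‖flow f t₀ t x - flow f t₀ t y‖
      ≤ D / d * Real.exp (c * (t - τ)) * ‖flow f t₀ τ x - flow f t₀ τ y‖ :=
        (isSolution_flow hf x).norm_sub_le_of_matrixMeasure_le (isSolution_flow hf y) hd0 hd hD
          hτ0 htτ (fun s hs => hf_diff s (hτ0.trans hs.1.le)) fun s hs v hv => hτ s hs.1.le v
            (segment_subset_convexHull (mem_image_of_mem _ hy) (mem_image_of_mem _ hx) hv)
    _ ≤ max 1 (D / d) * Real.exp (c * (t - t₀)) * ‖flow f t₀ τ x - flow f t₀ τ y‖ := by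
        gcongr
        exact le_max_right _ _

end Contraction

section Covering

variable {n : ℕ} {f : ℝ → (Fin n → ℝ) → (Fin n → ℝ)} {t₀ : ℝ} {N : Seminorm ℝ (Fin n → ℝ)}
  {K : Set (Fin n → ℝ)}

theorem card_Icc_floor_le {r : ℝ} (hr : 0 ≤ r) :
    ((Finset.Icc ⌊-r⌋ ⌊r⌋).card : ℝ) ≤ 2 * r + 2 := by
  have hle : ⌊-r⌋ ≤ ⌊r⌋ := Int.floor_mono (by linarith)
  have hcard : ((Finset.Icc ⌊-r⌋ ⌊r⌋).card : ℤ) = ⌊r⌋ + 1 - ⌊-r⌋ := by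
    rw [Int.card_Icc, Int.toNat_of_nonneg (by lia)]
  rw [← Int.cast_natCast, hcard]
  push_cast
  linarith [Int.floor_le r, Int.lt_floor_add_one (-r)]

theorem exists_finset_net_card_le {R δ : ℝ} (hR0 : 0 ≤ R) (hR : ∀ x ∈ K, ‖x‖ ≤ R) (hδ : 0 < δ) :
    ∃ E : Finset (Fin n → ℝ), ↑E ⊆ K ∧ (E.card : ℝ) ≤ (2 * (R / δ) + 2) ^ n ∧
      ∀ y ∈ K, ∃ x ∈ E, ‖y - x‖ < δ := by
  let cell : (Fin n → ℝ) → Fin n → ℤ := fun x i => ⌊x i / δ⌋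
  let cells : Finset (Fin n → ℤ) := Fintype.piFinset fun _ => Finset.Icc ⌊-(R / δ)⌋ ⌊R / δ⌋
  have hcell : MapsTo cell K cells := fun x hx => by
    simp only [cells, Fintype.coe_piFinset, Set.mem_pi, Finset.coe_Icc, mem_Icc]
    intro i _
    have hxi := abs_le.1 ((norm_le_pi_norm x i).trans (hR x hx))
    rw [← neg_div]
    exact ⟨Int.floor_mono (by gcongr; exact hxi.1), Int.floor_mono (by gcongr; exact hxi.2)⟩
  obtain ⟨E, hEK, hE⟩ := exists_subset_bijOn K cell
  have hE_maps : MapsTo cell E cells := hcell.mono_left hEK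
  lift E to Finset (Fin n → ℝ) using .of_finite_image
    (cells.finite_toSet.subset hE_maps.image_subset) hE.injOn
  refine ⟨E, hEK, ?_, fun y hy => ?_⟩
  · calc (E.card : ℝ) ≤ cells.card :=
          Nat.cast_le.2 (Finset.card_le_card_of_injOn cell hE_maps hE.injOn)
      _ = ((Finset.Icc ⌊-(R / δ)⌋ ⌊R / δ⌋).card : ℝ) ^ n := by
          simp [cells, -Int.card_Icc]
      _ ≤ (2 * (R / δ) + 2) ^ n := by
          gcongr
          exact card_Icc_floor_le (by positivity)
  · obtain ⟨x, hx, hxy⟩ := hE.surjOn (mem_image_of_mem cell hy)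
    refine ⟨x, hx, (pi_norm_lt_iff hδ).2 fun i => ?_⟩
    have hfloor := Int.abs_sub_lt_one_of_floor_eq_floor (congrFun hxy i).symm
    rwa [← sub_div, abs_div, abs_of_pos hδ, div_lt_one hδ] at hfloor

theorem spanningNumber_le_encard {T ε : ℝ} {E : Set (Fin n → ℝ)}
    (hE : IsSpanning N f t₀ K T ε E) : spanningNumber N f t₀ K T ε ≤ E.encard :=
  iInf₂_le E hE

theorem isSpanning_of_forall_exists_norm_sub_lt {A c T ε : ℝ} (hA : 0 < A) (hc : 0 ≤ c)
    (hflow : ∀ x ∈ K, ∀ y ∈ K, ∀ t, t₀ ≤ t →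
      N (flow f t₀ t x - flow f t₀ t y) ≤ A * Real.exp (c * (t - t₀)) * ‖x - y‖)
    {E : Set (Fin n → ℝ)} (hEK : E ⊆ K)
    (hE : ∀ y ∈ K, ∃ x ∈ E, ‖y - x‖ < ε / (A * Real.exp (c * T))) :
    IsSpanning N f t₀ K T ε E := by
  refine ⟨hEK, fun y hy => ?_⟩
  obtain ⟨x, hx, hxy⟩ := hE y hy
  refine ⟨x, hx, fun t ht => ?_⟩
  calc N (flow f t₀ t y - flow f t₀ t x)
      ≤ A * Real.exp (c * (t - t₀)) * ‖y - x‖ := hflow y hy x (hEK hx) t ht.1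
    _ ≤ A * Real.exp (c * T) * ‖y - x‖ := by
        gcongr
        linarith [ht.2]
    _ < ε := (lt_div_iff₀' (by positivity)).1 hxy

theorem spanningNumber_le_exp {R A c T ε : ℝ} (hR0 : 0 ≤ R) (hR : ∀ x ∈ K, ‖x‖ ≤ R) (hc : 0 ≤ c)
    (hT : 0 ≤ T) (hε : 0 < ε) (hεA : ε ≤ A)
    (hflow : ∀ x ∈ K, ∀ y ∈ K, ∀ t, t₀ ≤ t →
      N (flow f t₀ t x - flow f t₀ t y) ≤ A * Real.exp (c * (t - t₀)) * ‖x - y‖) :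
    (spanningNumber N f t₀ K T ε : ENNReal) ≤
      ENNReal.ofReal (((2 * R + 2) * (A / ε)) ^ n * Real.exp (n * c * T)) := by
  have hA0 : 0 < A := hε.trans_le hεA
  let δ := ε / (A * Real.exp (c * T))
  have hδ0 : 0 < δ := by positivity
  have hδ1 : δ ≤ 1 := (div_le_one (by positivity)).2 <|
    hεA.trans (le_mul_of_one_le_right hA0.le (Real.one_le_exp (by positivity)))
  obtain ⟨E, hEK, hcard, hnet⟩ := exists_finset_net_card_le hR0 hR hδ0
  have hspan : IsSpanning N f t₀ K T ε E :=
    isSpanning_of_forall_exists_norm_sub_lt hA0 hc hflow hEK hnet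
  have hcard' : (E.card : ℝ) ≤ ((2 * R + 2) * (A / ε)) ^ n * Real.exp (n * c * T) :=
    calc (E.card : ℝ) ≤ (2 * (R / δ) + 2 / δ) ^ n := by
          refine hcard.trans ?_
          gcongr
          exact (le_div_iff₀ hδ0).2 (by linarith)
      _ = ((2 * R + 2) * (A / ε)) ^ n * Real.exp (n * c * T) := by
          rw [mul_assoc (n : ℝ), Real.exp_nat_mul, ← mul_pow]
          congr 1
          simp only [δ]
          field_simp
  calc (spanningNumber N f t₀ K T ε : ENNReal) ≤ ((E.card : ℕ∞) : ENNReal) :=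
        ENat.toENNReal_le.2 ((spanningNumber_le_encard hspan).trans_eq
          (encard_coe_eq_coe_finsetCard E))
    _ = ENNReal.ofReal E.card := by simp
    _ ≤ _ := ENNReal.ofReal_le_ofReal hcard'

theorem exists_spanningNumber_le_exp (N : Seminorm ℝ (Fin n → ℝ)) (hK : Bornology.IsBounded K)
    {B c : ℝ} (hc : 0 ≤ c) (hB : ∀ x ∈ K, ∀ y ∈ K, ∀ t, t₀ ≤ t →
      ‖flow f t₀ t x - flow f t₀ t y‖ ≤ B * Real.exp (c * (t - t₀)) * ‖x - y‖)
    {ε : ℝ} (hε : 0 < ε) :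
    ∃ C : ℝ, ∀ T, 0 ≤ T →
      (spanningNumber N f t₀ K T ε : ENNReal) ≤ ENNReal.ofReal (C * Real.exp (n * c * T)) := by
  obtain ⟨R, hR0, hR⟩ := hK.exists_pos_norm_le
  obtain ⟨D, hD0, hD⟩ := exists_seminorm_le_mul_norm N
  refine ⟨_, fun T hT => spanningNumber_le_exp hR0.le hR hc hT hε (le_max_left ε (D * B)) ?_⟩
  intro x hx y hy t ht
  calc N (flow f t₀ t x - flow f t₀ t y)
      ≤ D * (B * Real.exp (c * (t - t₀)) * ‖x - y‖) :=
        (hD _).trans (by gcongr; exact hB x hx y hy t ht)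
    _ = D * B * Real.exp (c * (t - t₀)) * ‖x - y‖ := by ring
    _ ≤ max ε (D * B) * Real.exp (c * (t - t₀)) * ‖x - y‖ := by
        gcongr
        exact le_max_right _ _

end Covering

section Differentiability

variable {n : ℕ} {f : ℝ → (Fin n → ℝ) → (Fin n → ℝ)} {t₀ : ℝ}
  (hf : ForwardComplete f t₀) (hf_lip : LocallyLipschitzInState f t₀)

include hf hf_lip

theorem exists_norm_flow_sub_flow_sub_le (T r : ℝ) :
    ∃ C : ℝ, ∀ x ∈ Metric.closedBall 0 r, ∀ y ∈ Metric.closedBall 0 r,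
      ∀ s ∈ Icc t₀ T, ∀ t ∈ Icc t₀ T,
        ‖flow f t₀ s x - flow f t₀ s y - (flow f t₀ t x - flow f t₀ t y)‖ ≤ C * |s - t| := by
  obtain ⟨R, hR⟩ := exists_norm_flow_le hf hf_lip T r
  obtain ⟨L, hL⟩ := exists_norm_apply_flow_sub_le hf hf_lip T r
  refine ⟨L * (R + R), fun x hx y hy s hs t ht => ?_⟩
  have hx_sol := isSolution_flow hf x
  have hy_sol := isSolution_flow hf y
  have hintegral : flow f t₀ s x - flow f t₀ s y - (flow f t₀ t x - flow f t₀ t y) =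
      ∫ u in t..s, (f u (flow f t₀ u x) - f u (flow f t₀ u y)) := by
    rw [intervalIntegral.integral_sub (hx_sol.intervalIntegrable ht.1 hs.1)
      (hy_sol.intervalIntegrable ht.1 hs.1), ← hx_sol.sub_eq_integral ht.1 hs.1,
      ← hy_sol.sub_eq_integral ht.1 hs.1]
    abel
  rw [hintegral]
  refine intervalIntegral.norm_integral_le_of_norm_le_const fun u hu => ?_
  have hu' : u ∈ Icc t₀ T := uIcc_subset_Icc ht hs (uIoc_subset_uIcc hu)
  refine (hL x hx y hy u hu').trans ?_
  gcongr
  exact (norm_sub_le _ _).trans (add_le_add (hR x hx u hu') (hR y hy u hu'))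

-- Subtracting the orbit of the origin removes the forcing `f(t, 0)`, which need not be bounded:
-- unlike the flow itself, the difference is Lipschitz in time.
theorem exists_lipschitzOnWith_flow_sub_flow_zero (T r : ℝ) :
    ∃ C : NNReal, LipschitzOnWith C
      (fun z : (Fin n → ℝ) × ℝ => flow f t₀ z.2 z.1 - flow f t₀ z.2 0)
      (Metric.closedBall 0 r ×ˢ Icc t₀ T) := by
  obtain ⟨C₁, hC₁⟩ := exists_lipschitzOnWith_flow hf hf_lip T r
  obtain ⟨C₂, hC₂⟩ := exists_norm_flow_sub_flow_sub_le hf hf_lip T r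
  refine ⟨C₁ + C₂.toNNReal, LipschitzOnWith.of_dist_le_mul ?_⟩
  rintro ⟨x, s⟩ ⟨hx, hs⟩ ⟨y, t⟩ ⟨hy, ht⟩
  have h0 : (0 : Fin n → ℝ) ∈ Metric.closedBall 0 r :=
    Metric.mem_closedBall_self (dist_nonneg.trans (Metric.mem_closedBall.1 hx))
  have hsplit : flow f t₀ s x - flow f t₀ s 0 - (flow f t₀ t y - flow f t₀ t 0) =
      (flow f t₀ s x - flow f t₀ s y) +
        (flow f t₀ s y - flow f t₀ s 0 - (flow f t₀ t y - flow f t₀ t 0)) := by abel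
  calc dist (flow f t₀ s x - flow f t₀ s 0) (flow f t₀ t y - flow f t₀ t 0)
      ≤ C₁ * dist x y + C₂.toNNReal * dist s t := by
        rw [dist_eq_norm, hsplit, dist_eq_norm x y, Real.dist_eq]
        refine (norm_add_le _ _).trans (add_le_add ((hC₁ s hs).norm_sub_le hx hy)
          ((hC₂ y hy 0 h0 s hs t ht).trans ?_))
        gcongr
        exact Real.le_coe_toNNReal C₂
    _ ≤ (C₁ + C₂.toNNReal : NNReal) * dist (x, s) (y, t) := by
        rw [NNReal.coe_add, add_mul, Prod.dist_eq]
        gcongr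
        · exact le_max_left _ _
        · exact le_max_right _ _

theorem ae_differentiableAt_flow {T : ℝ} (hT : t₀ ≤ T) :
    ∀ᵐ x, DifferentiableAt ℝ (flow f t₀ T) x := by
  have hball : ∀ᵐ x, ∀ k : ℕ, x ∈ Metric.ball 0 (k : ℝ) →
      DifferentiableAt ℝ (flow f t₀ T) x := by
    refine ae_all_iff.2 fun k => ?_
    obtain ⟨C, hC⟩ := exists_lipschitzOnWith_flow hf hf_lip T k
    filter_upwards [((hC T ⟨hT, le_rfl⟩).mono
      Metric.ball_subset_closedBall).ae_differentiableWithinAt_of_mem] with x hx hxk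
    exact (hx hxk).differentiableAt (Metric.isOpen_ball.mem_nhds hxk)
  filter_upwards [hball] with x hx
  obtain ⟨k, hk⟩ := exists_nat_gt ‖x‖
  exact hx k (mem_ball_zero_iff.2 hk)

theorem ae_ae_differentiableAt_flow :
    ∀ᵐ x, ∀ᵐ t, t₀ < t → DifferentiableAt ℝ (flow f t₀ t) x := by
  let G : (Fin n → ℝ) × ℝ → (Fin n → ℝ) := fun z => flow f t₀ z.2 z.1 - flow f t₀ z.2 0
  have hG : ∀ᵐ z ∂(volume : Measure (Fin n → ℝ)).prod (volume : Measure ℝ), ∀ k : ℕ,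
      z ∈ Metric.ball 0 (k : ℝ) ×ˢ Ioo t₀ k → DifferentiableAt ℝ G z := by
    refine ae_all_iff.2 fun k => ?_
    obtain ⟨C, hC⟩ := exists_lipschitzOnWith_flow_sub_flow_zero hf hf_lip k k
    filter_upwards [(hC.mono (prod_mono Metric.ball_subset_closedBall
      Ioo_subset_Icc_self)).ae_differentiableWithinAt_of_mem] with z hz hzk
    exact (hz hzk).differentiableAt ((Metric.isOpen_ball.prod isOpen_Ioo).mem_nhds hzk)
  filter_upwards [Measure.ae_ae_of_ae_prod hG] with x hx
  filter_upwards [hx] with t ht htt₀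
  obtain ⟨k, hk⟩ := exists_nat_gt (max ‖x‖ t)
  have hGxt : DifferentiableAt ℝ G (x, t) := ht k
    ⟨mem_ball_zero_iff.2 ((le_max_left _ _).trans_lt hk), htt₀, (le_max_right _ _).trans_lt hk⟩
  have hslice : DifferentiableAt ℝ (fun y => G (y, t)) x :=
    hGxt.comp (f := fun y => (y, t)) x (differentiableAt_id.prodMk (differentiableAt_const t))
  simpa [G] using hslice.add_const (flow f t₀ t 0)

end Differentiability

section BoundedConvergence

variable {ι E : Type*} [NormedAddCommGroup E] {l : Filter ι} [l.IsCountablyGenerated]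
  {F : ι → ℝ → E} {g : ℝ → E} {a b B : ℝ}

theorem intervalIntegrable_of_tendsto_of_norm_le [l.NeBot]
    (hF : ∀ i, AEStronglyMeasurable (F i) (volume.restrict (uIoc a b)))
    (hB : ∀ᶠ i in l, ∀ t ∈ uIoc a b, ‖F i t‖ ≤ B)
    (hlim : ∀ᵐ t, t ∈ uIoc a b → Tendsto (fun i => F i t) l (𝓝 (g t))) :
    IntervalIntegrable g volume a b := by
  have hmeas : AEStronglyMeasurable g (volume.restrict (uIoc a b)) :=
    aestronglyMeasurable_of_tendsto_ae l hF ((ae_restrict_iff' measurableSet_uIoc).2 hlim)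
  refine intervalIntegrable_iff.2 (.of_bound measure_Ioc_lt_top hmeas B ?_)
  refine (ae_restrict_iff' measurableSet_uIoc).2 ?_
  filter_upwards [hlim] with t ht hmem
  exact le_of_tendsto (ht hmem).norm (hB.mono fun i hi => hi t hmem)

theorem tendsto_intervalIntegral_of_norm_le [NormedSpace ℝ E]
    (hF : ∀ i, AEStronglyMeasurable (F i) (volume.restrict (uIoc a b)))
    (hB : ∀ᶠ i in l, ∀ t ∈ uIoc a b, ‖F i t‖ ≤ B)
    (hlim : ∀ᵐ t, t ∈ uIoc a b → Tendsto (fun i => F i t) l (𝓝 (g t))) :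
    Tendsto (fun i => ∫ t in a..b, F i t) l (𝓝 (∫ t in a..b, g t)) :=
  intervalIntegral.tendsto_integral_filter_of_dominated_convergence (fun _ => B)
    (Eventually.of_forall hF)
    (hB.mono fun _ hi => ae_of_all _ hi) intervalIntegrable_const hlim

end BoundedConvergence

section Variational

variable {n : ℕ} {f : ℝ → (Fin n → ℝ) → (Fin n → ℝ)} {t₀ : ℝ} {x : Fin n → ℝ} {a b : ℝ}

theorem tendsto_slope_apply_flow {t : ℝ} (hf_diff : Differentiable ℝ (f t))
    (hx : DifferentiableAt ℝ (flow f t₀ t) x) (e : Fin n → ℝ) :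
    Tendsto (fun h : ℝ => h⁻¹ • (f t (flow f t₀ t (x + h • e)) - f t (flow f t₀ t x))) (𝓝[≠] 0)
      (𝓝 ((jacobian f t (flow f t₀ t x) * jacobian (flow f t₀) t x).mulVec e)) := by
  rw [← Matrix.mulVec_mulVec, ← fderiv_apply_eq_jacobian_mulVec, ← fderiv_apply_eq_jacobian_mulVec]
  exact (((hf_diff _).hasFDerivAt.comp x hx.hasFDerivAt).hasLineDerivAt e).tendsto_slope_zero

theorem intervalIntegrable_slope_apply_flow (hf : ForwardComplete f t₀) (ha : t₀ ≤ a)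
    (hb : t₀ ≤ b) (x e : Fin n → ℝ) (h : ℝ) : IntervalIntegrable
      (fun t => h⁻¹ • (f t (flow f t₀ t (x + h • e)) - f t (flow f t₀ t x))) volume a b :=
  (((isSolution_flow hf _).intervalIntegrable ha hb).sub
    ((isSolution_flow hf _).intervalIntegrable ha hb)).smul h⁻¹

theorem integral_slope_apply_flow (hf : ForwardComplete f t₀) (ha : t₀ ≤ a)
    (hb : t₀ ≤ b) (x e : Fin n → ℝ) (h : ℝ) :
    ∫ t in a..b, h⁻¹ • (f t (flow f t₀ t (x + h • e)) - f t (flow f t₀ t x)) =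
      h⁻¹ • (flow f t₀ b (x + h • e) - flow f t₀ b x) -
        h⁻¹ • (flow f t₀ a (x + h • e) - flow f t₀ a x) := by
  have hxh := isSolution_flow hf (x + h • e)
  have hx := isSolution_flow hf x
  rw [intervalIntegral.integral_smul, intervalIntegral.integral_sub
    (hxh.intervalIntegrable ha hb) (hx.intervalIntegrable ha hb),
    ← hxh.sub_eq_integral ha hb, ← hx.sub_eq_integral ha hb, ← smul_sub]
  congr 1
  abel

variable (hf : ForwardComplete f t₀) (hf_lip : LocallyLipschitzInState f t₀)

include hf hf_lip

theorem exists_norm_slope_apply_flow_le (T : ℝ) (x e : Fin n → ℝ) :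
    ∃ B : ℝ, ∀ᶠ h : ℝ in 𝓝[≠] 0, ∀ t ∈ Icc t₀ T,
      ‖h⁻¹ • (f t (flow f t₀ t (x + h • e)) - f t (flow f t₀ t x))‖ ≤ B := by
  obtain ⟨C, hC⟩ := exists_lipschitzOnWith_flow hf hf_lip T (‖x‖ + 1)
  obtain ⟨L, hL⟩ := exists_norm_apply_flow_sub_le hf hf_lip T (‖x‖ + 1)
  refine ⟨L * (C * ‖e‖), ?_⟩
  have hx : x ∈ Metric.closedBall 0 (‖x‖ + 1) := by simp
  have hnear : ∀ᶠ h : ℝ in 𝓝[≠] 0, ‖x + h • e‖ ≤ ‖x‖ + 1 := by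
    have hcont : ContinuousAt (fun h : ℝ => ‖x + h • e‖) 0 := by fun_prop
    exact nhdsWithin_le_nhds (hcont.eventually_le_const (by simp))
  filter_upwards [hnear, self_mem_nhdsWithin] with h hxh (hh : h ≠ 0) t ht
  rw [← mem_closedBall_zero_iff] at hxh
  rw [norm_smul, norm_inv, inv_mul_le_iff₀ (norm_pos_iff.2 hh)]
  calc ‖f t (flow f t₀ t (x + h • e)) - f t (flow f t₀ t x)‖
      ≤ L * (C * ‖x + h • e - x‖) := (hL _ hxh x hx t ht).trans
        (mul_le_mul_of_nonneg_left ((hC t ht).norm_sub_le hxh hx) L.coe_nonneg)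
    _ = ‖h‖ * (L * (C * ‖e‖)) := by
        rw [add_sub_cancel_left, norm_smul]
        ring

variable (hf_diff : ∀ t, t₀ ≤ t → Differentiable ℝ (f t))
  (hx : ∀ᵐ t, t₀ < t → DifferentiableAt ℝ (flow f t₀ t) x)

include hf_diff hx

theorem jacobian_flow_mulVec_sub_eq_integral (ha : t₀ ≤ a) (hab : a ≤ b) (e : Fin n → ℝ) :
    IntervalIntegrable (fun t =>
      (jacobian f t (flow f t₀ t x) * jacobian (flow f t₀) t x).mulVec e) volume a b ∧
    (DifferentiableAt ℝ (flow f t₀ a) x → DifferentiableAt ℝ (flow f t₀ b) x →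
      (jacobian (flow f t₀) b x).mulVec e - (jacobian (flow f t₀) a x).mulVec e =
        ∫ t in a..b, (jacobian f t (flow f t₀ t x) * jacobian (flow f t₀) t x).mulVec e) := by
  have hb := ha.trans hab
  obtain ⟨B, hB⟩ := exists_norm_slope_apply_flow_le hf hf_lip b x e
  have hmeas (h : ℝ) :=
    (intervalIntegrable_slope_apply_flow hf ha hb x e h).def'.aestronglyMeasurable
  have hbound : ∀ᶠ h : ℝ in 𝓝[≠] 0, ∀ t ∈ uIoc a b,
      ‖h⁻¹ • (f t (flow f t₀ t (x + h • e)) - f t (flow f t₀ t x))‖ ≤ B :=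
    hB.mono fun h hh t ht => by
      rw [uIoc_of_le hab] at ht
      exact hh t ⟨ha.trans ht.1.le, ht.2⟩
  have hlim : ∀ᵐ t, t ∈ uIoc a b → Tendsto (fun h : ℝ =>
      h⁻¹ • (f t (flow f t₀ t (x + h • e)) - f t (flow f t₀ t x))) (𝓝[≠] 0)
      (𝓝 ((jacobian f t (flow f t₀ t x) * jacobian (flow f t₀) t x).mulVec e)) := by
    filter_upwards [hx] with t hxt ht
    rw [uIoc_of_le hab] at ht
    have ht₀ := ha.trans_lt ht.1
    exact tendsto_slope_apply_flow (hf_diff t ht₀.le) (hxt ht₀) e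
  refine ⟨intervalIntegrable_of_tendsto_of_norm_le hmeas hbound hlim, fun hxa hxb => ?_⟩
  have hslopes := tendsto_intervalIntegral_of_norm_le hmeas hbound hlim
  simp only [integral_slope_apply_flow hf ha hb] at hslopes
  simp only [← fderiv_apply_eq_jacobian_mulVec] at hslopes ⊢
  exact tendsto_nhds_unique ((hxb.hasFDerivAt.hasLineDerivAt e).tendsto_slope_zero.sub
    (hxa.hasFDerivAt.hasLineDerivAt e).tendsto_slope_zero) hslopes

theorem jacobian_flow_apply_sub_eq_integral (ha : t₀ ≤ a) (hab : a ≤ b) (i j : Fin n) :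
    IntervalIntegrable (fun t =>
      (jacobian f t (flow f t₀ t x) * jacobian (flow f t₀) t x) i j) volume a b ∧
    (DifferentiableAt ℝ (flow f t₀ a) x → DifferentiableAt ℝ (flow f t₀ b) x →
      jacobian (flow f t₀) b x i j - jacobian (flow f t₀) a x i j =
        ∫ t in a..b, (jacobian f t (flow f t₀ t x) * jacobian (flow f t₀) t x) i j) := by
  obtain ⟨hint, heq⟩ :=
    jacobian_flow_mulVec_sub_eq_integral hf hf_lip hf_diff hx ha hab (Pi.single j 1)
  simp only [Matrix.mulVec_single_one] at hint heq
  let π : (Fin n → ℝ) →L[ℝ] ℝ := ContinuousLinearMap.proj i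
  exact ⟨⟨π.integrable_comp hint.1, π.integrable_comp hint.2⟩, fun hxa hxb =>
    (congrArg π (heq hxa hxb)).trans (π.intervalIntegral_comp_comm hint).symm⟩

theorem exp_mul_abs_det_jacobian_flow_le (ha : t₀ ≤ a) (hab : a ≤ b)
    (hxa : DifferentiableAt ℝ (flow f t₀ a) x) (hxb : DifferentiableAt ℝ (flow f t₀ b) x) {c : ℝ}
    (hc : ∀ t ∈ Ioo a b, c ≤ (jacobian f t (flow f t₀ t x)).trace) :
    Real.exp (c * (b - a)) * |(jacobian (flow f t₀) a x).det| ≤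
      |(jacobian (flow f t₀) b x).det| := by
  let A : ℝ → Matrix (Fin n) (Fin n) ℝ := fun t => jacobian f t (flow f t₀ t x)
  let J : ℝ → Matrix (Fin n) (Fin n) ℝ := fun t => jacobian (flow f t₀) t x
  -- `J t` is junk at the times where the flow is not differentiable; `Z` is its absolutely
  -- continuous version.
  let Z : ℝ → Matrix (Fin n) (Fin n) ℝ := fun t =>
    Matrix.of fun i j => J a i j + ∫ s in a..t, (A s * J s) i j
  have hint (i j : Fin n) : IntervalIntegrable (fun t => (A t * J t) i j) volume a b :=
    (jacobian_flow_apply_sub_eq_integral hf hf_lip hf_diff hx ha hab i j).1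
  have hZJ {t : ℝ} (ht : a ≤ t) (hxt : DifferentiableAt ℝ (flow f t₀ t) x) : Z t = J t := by
    ext i j
    exact add_eq_of_eq_sub'
      ((jacobian_flow_apply_sub_eq_integral hf hf_lip hf_diff hx ha ht i j).2 hxa hxt).symm
  have hZ_ac (i j : Fin n) : AbsolutelyContinuousOnInterval (fun t => Z t i j) a b :=
    (absolutelyContinuousOnInterval_const _ a b).fun_add
      ((hint i j).absolutelyContinuousOnInterval_intervalIntegral left_mem_uIcc)
  have hZ_deriv : ∀ᵐ t, t ∈ Ioo a b →
      ∀ i j, HasDerivAt (fun s => Z s i j) ((A t * Z t) i j) t := by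
    have hftc : ∀ᵐ t, ∀ i j, t ∈ uIcc a b → ∀ c ∈ uIcc a b,
        HasDerivAt (fun s => ∫ r in c..s, (A r * J r) i j) ((A t * J t) i j) t :=
      ae_all_iff.2 fun i => ae_all_iff.2 fun j => (hint i j).ae_hasDerivAt_integral
    filter_upwards [hftc, hx] with t ht hxt hmem i j
    rw [hZJ hmem.1.le (hxt (ha.trans_lt hmem.1))]
    exact (ht i j (Icc_subset_uIcc (Ioo_subset_Icc_self hmem)) a left_mem_uIcc).const_add _
  simpa only [hZJ le_rfl hxa, hZJ hab hxb] using exp_mul_abs_det_le hab hZ_ac hZ_deriv hc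

end Variational

section Volume

variable {n : ℕ} {f : ℝ → (Fin n → ℝ) → (Fin n → ℝ)} {t₀ : ℝ} {K : Set (Fin n → ℝ)}
  (hf : ForwardComplete f t₀) (hf_lip : LocallyLipschitzInState f t₀)

include hf hf_lip

theorem volume_reachableSet_eq_zero {T : ℝ} (hT : t₀ ≤ T) (hK : volume K = 0) :
    volume (reachableSet f t₀ T K) = 0 := by
  have hball (k : ℕ) : volume (flow f t₀ T '' (K ∩ Metric.closedBall 0 k)) = 0 := by
    obtain ⟨C, hC⟩ := exists_lipschitzOnWith_flow hf hf_lip T k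
    have himage := ((hC T ⟨hT, le_rfl⟩).mono inter_subset_right).hausdorffMeasure_image_le
      (Nat.cast_nonneg (Fintype.card (Fin n))) (s := K ∩ Metric.closedBall 0 k)
    rw [hausdorffMeasure_pi_real, measure_inter_null_of_null_left _ hK, mul_zero] at himage
    exact nonpos_iff_eq_zero.1 himage
  have hcover : reachableSet f t₀ T K ⊆ ⋃ k : ℕ, flow f t₀ T '' (K ∩ Metric.closedBall 0 k) := by
    rintro _ ⟨x, hx, rfl⟩
    obtain ⟨k, hk⟩ := exists_nat_ge ‖x‖
    exact mem_iUnion.2 ⟨k, mem_image_of_mem _ ⟨hx, mem_closedBall_zero_iff.2 hk⟩⟩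
  exact measure_mono_null hcover (measure_iUnion_null hball)

theorem lintegral_abs_det_jacobian_flow {T : ℝ} (hT : t₀ ≤ T) (hK : NullMeasurableSet K) :
    ∫⁻ x in K, ENNReal.ofReal |(jacobian (flow f t₀) T x).det| =
      volume (reachableSet f t₀ T K) := by
  let S : Set (Fin n → ℝ) := K ∩ {x | DifferentiableAt ℝ (flow f t₀ T) x}
  have hSK : S =ᵐ[volume] K := inter_ae_eq_left_of_ae_eq_univ
    (eventuallyEq_univ.2 (ae_differentiableAt_flow hf hf_lip hT))
  have himage : flow f t₀ T '' S =ᵐ[volume] reachableSet f t₀ T K := by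
    refine (image_mono inter_subset_left).eventuallyLE.antisymm (ae_le_set.2 ?_)
    change volume (flow f t₀ T '' K \ flow f t₀ T '' S) = 0
    rw [← image_sdiff (injective_flow hf hf_lip hT)]
    exact volume_reachableSet_eq_zero hf hf_lip hT (ae_le_set.1 hSK.symm.le)
  simp only [jacobian, LinearMap.det_toMatrix']
  rw [← setLIntegral_congr hSK, ← measure_congr himage]
  exact lintegral_abs_det_fderiv_eq_addHaar_image₀ volume (hK.congr hSK.symm)
    (fun x hx => hx.2.hasFDerivAt.hasFDerivWithinAt) (injective_flow hf hf_lip hT).injOn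

theorem exp_mul_volume_reachableSet_le (hf_diff : ∀ t, t₀ ≤ t → Differentiable ℝ (f t))
    (hK : NullMeasurableSet K) {a b c : ℝ} (ha : t₀ ≤ a) (hab : a ≤ b)
    (hc : ∀ t ∈ Ioo a b, ∀ v ∈ reachableSet f t₀ t K, c ≤ (jacobian f t v).trace) :
    ENNReal.ofReal (Real.exp (c * (b - a))) * volume (reachableSet f t₀ a K) ≤
      volume (reachableSet f t₀ b K) := by
  have hb := ha.trans hab
  rw [← lintegral_abs_det_jacobian_flow hf hf_lip ha hK,
    ← lintegral_abs_det_jacobian_flow hf hf_lip hb hK, ← lintegral_const_mul' _ _ (by simp)]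
  refine lintegral_mono_ae ((ae_restrict_iff'₀ hK).2 ?_)
  filter_upwards [ae_differentiableAt_flow hf hf_lip ha, ae_differentiableAt_flow hf hf_lip hb,
    ae_ae_differentiableAt_flow hf hf_lip] with x hxa hxb hx hxK
  rw [← ENNReal.ofReal_mul (Real.exp_pos _).le]
  exact ENNReal.ofReal_le_ofReal (exp_mul_abs_det_jacobian_flow_le hf hf_lip hf_diff hx ha hab
    hxa hxb fun t ht => hc t ht _ (mem_image_of_mem _ hxK))

theorem exists_le_trace_jacobian (hf_bdd : JacobianLocallyBounded f t₀)
    (hK : Bornology.IsBounded K) (T : ℝ) :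
    ∃ k, ∀ t ∈ Icc t₀ T, ∀ v ∈ reachableSet f t₀ t K, k ≤ (jacobian f t v).trace := by
  obtain ⟨r, hr⟩ := hK.subset_closedBall 0
  obtain ⟨R, hR⟩ := exists_norm_flow_le hf hf_lip T r
  obtain ⟨C, hC⟩ := hf_bdd T R
  refine ⟨∑ _i : Fin n, -C, fun t ht => ?_⟩
  rintro _ ⟨x, hx, rfl⟩
  exact Finset.sum_le_sum fun i _ => (abs_le.1 (hC t ht _ (hR x (hr hx) t ht) i i)).1

theorem volume_reachableSet_ne_zero (hf_bdd : JacobianLocallyBounded f t₀)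
    (hf_diff : ∀ t, t₀ ≤ t → Differentiable ℝ (f t)) (hK_bdd : Bornology.IsBounded K)
    (hK : NullMeasurableSet K) (hK_vol : volume K ≠ 0) {T : ℝ} (hT : t₀ ≤ T) :
    volume (reachableSet f t₀ T K) ≠ 0 := by
  obtain ⟨k, hk⟩ := exists_le_trace_jacobian hf hf_lip hf_bdd hK_bdd T
  have hle := exp_mul_volume_reachableSet_le hf hf_lip hf_diff hK le_rfl hT fun t ht =>
    hk t (Ioo_subset_Icc_self ht)
  have hself : reachableSet f t₀ t₀ K = K := by simp [reachableSet, flow_self hf]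
  rw [hself] at hle
  refine (lt_of_lt_of_le (ENNReal.mul_pos ?_ hK_vol) hle).ne'
  simp [Real.exp_pos]

end Volume

section Separation

variable {n : ℕ} {f : ℝ → (Fin n → ℝ) → (Fin n → ℝ)} {t₀ : ℝ} {K : Set (Fin n → ℝ)}

theorem exists_le_trace_of_lt_chiCheck {c : ℝ} (h : c < chiCheck f t₀ K) :
    ∃ τ, t₀ ≤ τ ∧ ∀ t, τ ≤ t → ∀ v ∈ reachableSet f t₀ t K, c ≤ (jacobian f t v).trace := by
  obtain ⟨τ, hτ⟩ := eventually_atTop.1 (eventually_lt_of_lt_liminf h)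
  refine ⟨max τ t₀, le_max_right _ _, fun t ht v hv => EReal.coe_le_coe_iff.1 ?_⟩
  exact (hτ t ((le_max_left _ _).trans ht)).le.trans
    (iInf₂_le (f := fun v _ => ((jacobian f t v).trace : EReal)) v hv)

theorem exists_isSpanning_encard_eq (N : Seminorm ℝ (Fin n → ℝ)) (T : ℝ) {ε : ℝ} (hε : 0 < ε) :
    ∃ E, IsSpanning N f t₀ K T ε E ∧ E.encard = spanningNumber N f t₀ K T ε := by
  have hK : IsSpanning N f t₀ K T ε K := ⟨Subset.rfl, fun y hy => ⟨y, hy, by simp [hε]⟩⟩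
  have hne : {E | IsSpanning N f t₀ K T ε E}.Nonempty := ⟨K, hK⟩
  rw [spanningNumber, ← sInf_image]
  exact csInf_mem (hne.image encard)

theorem IsSpanning.reachableSet_subset {N : Seminorm ℝ (Fin n → ℝ)} {T ε : ℝ}
    {E : Set (Fin n → ℝ)} (hE : IsSpanning N f t₀ K T ε E) (hT : 0 ≤ T) :
    reachableSet f t₀ (t₀ + T) K ⊆
      ⋃ x ∈ E, (fun v => v - flow f t₀ (t₀ + T) x) ⁻¹' {v | N v < ε} := by
  rintro _ ⟨y, hy, rfl⟩
  obtain ⟨x, hx, hxy⟩ := hE.2 y hy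
  exact mem_iUnion₂.2 ⟨x, hx, hxy _ ⟨by linarith, le_rfl⟩⟩

theorem volume_reachableSet_le_spanningNumber_mul (N : Seminorm ℝ (Fin n → ℝ)) {T ε : ℝ}
    (hT : 0 ≤ T) (hε : 0 < ε) : volume (reachableSet f t₀ (t₀ + T) K) ≤
      (spanningNumber N f t₀ K T ε : ENNReal) * volume {v | N v < ε} := by
  obtain ⟨E, hE, hcard⟩ := exists_isSpanning_encard_eq (f := f) (t₀ := t₀) (K := K) N T hε
  rw [← hcard]
  rcases E.finite_or_infinite with hfin | hinf
  · lift E to Finset (Fin n → ℝ) using hfin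
    calc volume (reachableSet f t₀ (t₀ + T) K)
        ≤ ∑ x ∈ E, volume ((fun v => v - flow f t₀ (t₀ + T) x) ⁻¹' {v | N v < ε}) :=
          (measure_mono (hE.reachableSet_subset hT)).trans (measure_biUnion_finset_le _ _)
      _ = ((E : Set (Fin n → ℝ)).encard : ENNReal) * volume {v | N v < ε} := by
          simp only [sub_eq_add_neg, measure_preimage_add_right, Finset.sum_const, nsmul_eq_mul,
            encard_coe_eq_coe_finsetCard, ENat.toENNReal_coe]
  · have hopen : IsOpen {v | N v < ε} := isOpen_lt (continuous_seminorm N) continuous_const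
    rw [hinf.encard_eq, ENat.toENNReal_top,
      ENNReal.top_mul (hopen.measure_ne_zero volume ⟨0, by simp [hε]⟩)]
    exact le_top

theorem exists_exp_le_spanningNumber {N : Seminorm ℝ (Fin n → ℝ)} (hN : ∀ x, N x = 0 → x = 0)
    (hf : ForwardComplete f t₀) (hf_bdd : JacobianLocallyBounded f t₀)
    (hf_diff : ∀ t, t₀ ≤ t → Differentiable ℝ (f t)) (hK_bdd : Bornology.IsBounded K)
    (hK : NullMeasurableSet K) (hK_vol : volume K ≠ 0) {c : ℝ} (h : c < chiCheck f t₀ K)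
    {ε : ℝ} (hε : 0 < ε) :
    ∃ C : ℝ, 0 < C ∧ ∀ᶠ T in atTop, ENNReal.ofReal (C * Real.exp (c * T)) ≤
      (spanningNumber N f t₀ K T ε : ENNReal) := by
  have hf_lip := hf_bdd.locallyLipschitzInState hf_diff
  obtain ⟨τ, hτ, htrace⟩ := exists_le_trace_of_lt_chiCheck h
  let U := volume (reachableSet f t₀ τ K)
  let V := volume {v | N v < ε}
  have hUV : 0 < U / V := ENNReal.div_pos
    (volume_reachableSet_ne_zero hf hf_lip hf_bdd hf_diff hK_bdd hK hK_vol hτ)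
    (isBounded_seminorm_lt hN ε).measure_lt_top.ne
  obtain ⟨u, -, hu0, hu⟩ := ENNReal.lt_iff_exists_real_btwn.1 hUV
  rw [ENNReal.ofReal_pos] at hu0
  refine ⟨u * Real.exp (c * (t₀ - τ)), by positivity, ?_⟩
  filter_upwards [eventually_ge_atTop (τ - t₀)] with T hT
  have hTτ : τ ≤ t₀ + T := by linarith
  have hgrowth := exp_mul_volume_reachableSet_le hf hf_lip hf_diff hK hτ hTτ fun t ht =>
    htrace t ht.1.le
  calc ENNReal.ofReal (u * Real.exp (c * (t₀ - τ)) * Real.exp (c * T))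
      = ENNReal.ofReal (Real.exp (c * (t₀ + T - τ))) * ENNReal.ofReal u := by
        rw [mul_assoc, ← Real.exp_add, mul_comm, ENNReal.ofReal_mul (Real.exp_pos _).le]
        ring_nf
    _ ≤ ENNReal.ofReal (Real.exp (c * (t₀ + T - τ))) * (U / V) := by gcongr
    _ = ENNReal.ofReal (Real.exp (c * (t₀ + T - τ))) * U / V := (mul_div_assoc _ _ _).symm
    _ ≤ spanningNumber N f t₀ K T ε := ENNReal.div_le_of_le_mul
        (hgrowth.trans (volume_reachableSet_le_spanningNumber_mul N (by linarith) hε))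

end Separation

section Entropy

variable {n : ℕ} {f : ℝ → (Fin n → ℝ) → (Fin n → ℝ)} {t₀ : ℝ} {K : Set (Fin n → ℝ)}

theorem antitone_spanningNumber (N : Seminorm ℝ (Fin n → ℝ)) (f : ℝ → (Fin n → ℝ) → (Fin n → ℝ))
    (t₀ : ℝ) (K : Set (Fin n → ℝ)) (T : ℝ) : Antitone (spanningNumber N f t₀ K T) :=
  fun _ _ hε => le_iInf₂ fun E hE => iInf₂_le E ⟨hE.1, fun y hy =>
    (hE.2 y hy).imp fun _ hx => ⟨hx.1, fun t ht => (hx.2 t ht).trans_le hε⟩⟩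

theorem one_le_spanningNumber (N : Seminorm ℝ (Fin n → ℝ)) (hK : K.Nonempty) (T ε : ℝ) :
    1 ≤ spanningNumber N f t₀ K T ε := by
  obtain ⟨y, hy⟩ := hK
  exact le_iInf₂ fun E hE => one_le_encard_iff_nonempty.2 <|
    (hE.2 y hy).imp fun _ hx => hx.1

theorem tendsto_topEntropy (N : Seminorm ℝ (Fin n → ℝ)) (f : ℝ → (Fin n → ℝ) → (Fin n → ℝ))
    (t₀ : ℝ) (K : Set (Fin n → ℝ)) :
    Tendsto (fun ε : ℝ => limsup (fun T : ℝ =>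
      ((1 / T : ℝ) : EReal) * ENNReal.log (spanningNumber N f t₀ K T ε : ENNReal)) atTop)
      (𝓝[>] 0) (𝓝 (topEntropy N f t₀ K)) := by
  refine tendsto_nhds_limUnder ⟨_, Antitone.tendsto_nhdsGT (fun ε ε' hε => ?_) 0⟩
  refine limsup_le_limsup ?_
  filter_upwards [eventually_gt_atTop 0] with T hT
  gcongr
  exact antitone_spanningNumber N f t₀ K T hε

theorem tendsto_one_div_mul_log_exp {C : ℝ} (hC : 0 < C) (c : ℝ) :
    Tendsto (fun T : ℝ => ((1 / T : ℝ) : EReal) *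
      ENNReal.log (ENNReal.ofReal (C * Real.exp (c * T)))) atTop (𝓝 (c : EReal)) := by
  have hlim : Tendsto (fun T : ℝ => Real.log C * T⁻¹ + c) atTop (𝓝 c) := by
    simpa using (tendsto_inv_atTop_zero.const_mul (Real.log C)).add_const c
  refine ((continuous_coe_real_ereal.tendsto c).comp hlim).congr' ?_
  filter_upwards [eventually_gt_atTop 0] with T hT
  rw [ENNReal.log_ofReal_of_pos (by positivity), ← EReal.coe_mul,
    Real.log_mul hC.ne' (Real.exp_pos _).ne', Real.log_exp, Function.comp_apply]
  congr 1
  field_simp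

theorem topEntropy_le_of_spanningNumber_le {N : Seminorm ℝ (Fin n → ℝ)} {c : ℝ}
    (h : ∀ ε, 0 < ε → ∃ C : ℝ, ∀ᶠ T in atTop,
      (spanningNumber N f t₀ K T ε : ENNReal) ≤ ENNReal.ofReal (C * Real.exp (c * T))) :
    topEntropy N f t₀ K ≤ c := by
  refine le_of_tendsto (tendsto_topEntropy N f t₀ K) ?_
  filter_upwards [self_mem_nhdsWithin] with ε hε
  obtain ⟨C, hC⟩ := h ε hε
  have hC0 : 0 < max C 1 := by positivity
  refine (limsup_le_limsup ?_).trans (tendsto_one_div_mul_log_exp hC0 c).limsup_eq.le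
  filter_upwards [hC, eventually_gt_atTop 0] with T hCT hT
  gcongr
  refine hCT.trans ?_
  gcongr
  exact le_max_left C 1

theorem le_topEntropy_of_le_spanningNumber {N : Seminorm ℝ (Fin n → ℝ)} {c : ℝ}
    (h : ∀ ε, 0 < ε → ∃ C : ℝ, 0 < C ∧ ∀ᶠ T in atTop,
      ENNReal.ofReal (C * Real.exp (c * T)) ≤ (spanningNumber N f t₀ K T ε : ENNReal)) :
    c ≤ topEntropy N f t₀ K := by
  refine ge_of_tendsto (tendsto_topEntropy N f t₀ K) ?_
  filter_upwards [self_mem_nhdsWithin] with ε hε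
  obtain ⟨C, hC0, hC⟩ := h ε hε
  refine (tendsto_one_div_mul_log_exp hC0 c).limsup_eq.ge.trans (limsup_le_limsup ?_)
  filter_upwards [hC, eventually_gt_atTop 0] with T hCT hT
  gcongr

theorem topEntropy_nonneg (N : Seminorm ℝ (Fin n → ℝ)) (hK : K.Nonempty) :
    0 ≤ topEntropy N f t₀ K := by
  refine le_topEntropy_of_le_spanningNumber (c := 0) fun ε _ =>
    ⟨1, one_pos, Eventually.of_forall fun T => ?_⟩
  rw [zero_mul, Real.exp_zero, mul_one, ENNReal.ofReal_one]
  exact_mod_cast one_le_spanningNumber N hK T ε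

theorem topEntropy_le_mul_max_muHat (hn : 0 < n) (N : Seminorm ℝ (Fin n → ℝ))
    {M : Seminorm ℝ (Fin n → ℝ)} (hM : ∀ x, M x = 0 → x = 0) (hf : ForwardComplete f t₀)
    (hf_bdd : JacobianLocallyBounded f t₀) (hf_diff : ∀ t, t₀ ≤ t → Differentiable ℝ (f t))
    (hK : Bornology.IsBounded K) :
    topEntropy N f t₀ K ≤ (n : EReal) * max (muHat M f t₀ K) 0 := by
  have hn' : (0 : EReal) < n := by exact_mod_cast hn
  rw [← EReal.div_le_iff_le_mul hn' (EReal.natCast_ne_top n)]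
  refine EReal.le_of_forall_lt_iff_le.1 fun c hc => ?_
  obtain ⟨hc_mu, hc0⟩ := max_lt_iff.1 hc
  have hc0' : 0 ≤ c := (EReal.coe_pos.1 hc0).le
  obtain ⟨B, hB⟩ := exists_norm_flow_sub_le_exp hM hf_diff hf
    (hf_bdd.locallyLipschitzInState hf_diff) hK hc0' hc_mu
  rw [EReal.div_le_iff_le_mul hn' (EReal.natCast_ne_top n)]
  refine topEntropy_le_of_spanningNumber_le (c := n * c) fun ε hε => ?_
  obtain ⟨C, hC⟩ := exists_spanningNumber_le_exp N hK hc0' hB hε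
  exact ⟨C, (eventually_ge_atTop 0).mono hC⟩

theorem chiCheck_le_topEntropy {N : Seminorm ℝ (Fin n → ℝ)} (hN : ∀ x, N x = 0 → x = 0)
    (hf : ForwardComplete f t₀) (hf_bdd : JacobianLocallyBounded f t₀)
    (hf_diff : ∀ t, t₀ ≤ t → Differentiable ℝ (f t)) (hK_bdd : Bornology.IsBounded K)
    (hK : NullMeasurableSet K) (hK_vol : volume K ≠ 0) : chiCheck f t₀ K ≤ topEntropy N f t₀ K :=
  EReal.ge_of_forall_gt_iff_ge.1 fun _ hc => le_topEntropy_of_le_spanningNumber fun _ hε =>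
    exists_exp_le_spanningNumber hN hf hf_bdd hf_diff hK_bdd hK hK_vol hc hε

end Entropy

theorem theorem1_general {n : ℕ} (hn : 0 < n) (f : ℝ → (Fin n → ℝ) → (Fin n → ℝ)) (t₀ : ℝ)
    (hf_diff : ∀ t, t₀ ≤ t → Differentiable ℝ (f t))
    (hf_bdd : JacobianLocallyBounded f t₀)
    (hf_complete : ForwardComplete f t₀)
    (K : Set (Fin n → ℝ)) (hK_bdd : Bornology.IsBounded K) (hK : NullMeasurableSet K)
    (hK_vol : volume K ≠ 0)
    (N : Seminorm ℝ (Fin n → ℝ)) (hN : ∀ x, N x = 0 → x = 0)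
    (M : Seminorm ℝ (Fin n → ℝ)) (hM : ∀ x, M x = 0 → x = 0) :
    topEntropy N f t₀ K ≤ (n : EReal) * max (muHat M f t₀ K) 0 ∧
      max (chiCheck f t₀ K) 0 ≤ topEntropy N f t₀ K :=
  ⟨topEntropy_le_mul_max_muHat hn N hM hf_complete hf_bdd hf_diff hK_bdd,
    max_le (chiCheck_le_topEntropy hN hf_complete hf_bdd hf_diff hK_bdd hK hK_vol)
      (topEntropy_nonneg N (nonempty_of_measure_ne_zero hK_vol))⟩

theorem theorem1 {n : ℕ} (hn : 0 < n) (f : ℝ → (Fin n → ℝ) → (Fin n → ℝ)) (t₀ : ℝ)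
    (hf_time : PiecewiseContinuousInTime f t₀)
    (hf_state : ∀ t, t₀ ≤ t → ContDiff ℝ 1 (f t))
    (hf_bdd : JacobianLocallyBounded f t₀)
    (hf_complete : ForwardComplete f t₀)
    (K : Set (Fin n → ℝ)) (hK : IsCompact K) (hK_int : (interior K).Nonempty)
    -- `N` is the norm in the definition of entropy; `M` induces the matrix norm behind `μ`
    (N : Seminorm ℝ (Fin n → ℝ)) (hN : ∀ x, N x = 0 → x = 0)
    (M : Seminorm ℝ (Fin n → ℝ)) (hM : ∀ x, M x = 0 → x = 0) :
    topEntropy N f t₀ K ≤ (n : EReal) * max (muHat M f t₀ K) 0 ∧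
      max (chiCheck f t₀ K) 0 ≤ topEntropy N f t₀ K :=
  theorem1_general hn f t₀ (fun t ht => (hf_state t ht).differentiable one_ne_zero) hf_bdd
    hf_complete K hK.isBounded hK.measurableSet.nullMeasurableSet
    (Measure.measure_pos_of_nonempty_interior volume hK_int).ne' N hN M hM
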